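/- Let $s\ge 1$ and consider an explicit Runge–Kutta integrator with $S$ stages: one step of size $h$ for $\dot y=F(y)$ is $\Phi_h(y)=y+h\sum_{i=0}^{S-1} b_iF(g_i)$, where $g_i=y+h\sum_{j<i}a_{ij}F(g_j)$. Assume that it has order $s$, i.e. for every smooth $F$ on a finite-dimensional space the one-step error is $O(h^{s+1})$ as $h\to0$. Then there are constants $c,C>0$, depending only on $s$ and on the integrator, such that the following holds for all $d\ge 1$, all $f:\mathbb R^d\to\mathbb R$, all $\mu>0$ and $L$, and all $x^*\in\mathbb R^d$ for which: (a) $f$ is $\mu$-quasi-strongly convex with minimizer $x^*$, i.e. $f(x^*)\le f(x)$ and $f(x^*)\ge f(x)+\langle\nabla f(x),x^*-x\rangle+\frac\mu2\|x-x^*\|^2$ for all $x$; (b) the derivatives of $f$ up to order $s+1$ exist everywhere, and $\|\nabla^{(n)}f(x)\|\le L$ for all $x$ and $n=2,\dots,s+1$ (operator norm). Put $Q=L/\mu$ and $\gamma=\frac{s+3}{2(s+1)}$; for $y=(w,x)\in\mathbb R^d\times\mathbb R^d$ put $$F(y)=\Big(-2w-\frac{\nabla f(x)}{\mu\sqrt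 Q},\ \sqrt Q\,w\Big),\qquad \mathcal E(y)=\frac{2(f(x)-f(x^*))}{\mu}+\frac Q2\|w\|^2+\frac12\|x+\sqrt Q\,w-x^*\|^2 .$$ Let $y_0\in\mathbb R^d\times\mathbb R^d$ be arbitrary, let $y_{N+1}=\Phi_h(y_N)$ with $y_N=(w_N,x_N)$, and let $$h_{\max}=\frac{\max\{\mathcal E(y_0),Q\}^{-\gamma}}{2c^{1/(s+1)}}=\frac{\min\{\mathcal E(y_0)^{-\gamma},Q^{-\gamma}\}}{2c^{1/(s+1)}},$$ where $\mathcal E(y_0)^{-\gamma}$ is read as $+\infty$ if $\mathcal E(y_0)=0$. 1. If $0<h\le h_{\max}$, then $\mathcal E(y_N)\le(1-h/4)^N\,\mathcal E(y_0)$ for all $N\ge 0$. 2. Let $h=h_{\max}$. For every $\epsilon>0$ there is an $N$ such that $f(x_n)-f(x^*)\le\epsilon$ for all $n\ge N$, and the algorithm that performs $N$ integrator steps makes at most $$C\,S\,\max\{\mathcal E(y_0),Q\}^{\gamma}\,\log^+\!\Big(\frac{\mu\,\mathcal E(y_0)}{\epsilon}\Big)$$ evaluations of $\nabla f$, where $\log^+t=\max\{\log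 t,0\}$ and $\log^+0=0$. -/

import Mathlib

open scoped ContDiff Topology

noncomputable section

namespace HeavyBall

/-! ### Explicit Runge–Kutta integrators -/

/-- An explicit Runge–Kutta integrator with `stages` stages. Only the coefficients `a i j` with
`j < i < stages` and `b i` with `i < stages` are used. -/
structure ExplicitRK where
  stages : ℕ
  a : ℕ → ℕ → ℝ
  b : ℕ → ℝ

section RK

variable {V : Type*} [AddCommGroup V] [Module ℝ V]

/-- The `i`-th stage `g_i = y + h ∑_{j < i} a_{ij} F(g_j)`. -/
def ExplicitRK.stage (M : ExplicitRK) (F : V → V) (h : ℝ) (y : V) (i : ℕ) : V :=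
  y + h • ∑ j : Fin i, M.a i j • F (M.stage F h y j)
termination_by i
decreasing_by exact j.isLt

/-- One step `Φ_h(y) = y + h ∑_{i < S} b_i F(g_i)` of the integrator. -/
def ExplicitRK.step (M : ExplicitRK) (F : V → V) (h : ℝ) (y : V) : V :=
  y + h • ∑ i ∈ Finset.range M.stages, M.b i • F (M.stage F h y i)

/-- The numerical solution `y_0, y_1 = Φ_h(y_0), y_2 = Φ_h(y_1), …`. -/
def ExplicitRK.iter (M : ExplicitRK) (F : V → V) (h : ℝ) (y₀ : V) : ℕ → V
  | 0 => y₀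
  | n + 1 => M.step F h (M.iter F h y₀ n)

end RK

/-- The integrator has order (at least) `s`: for every smooth autonomous system `φ' = F(φ)` in
finite dimension, one step of size `h` has error `O(h ^ (s + 1))` as `h → 0`. -/
def ExplicitRK.HasOrder (M : ExplicitRK) (s : ℕ) : Prop :=
  ∀ (V : Type) [NormedAddCommGroup V] [NormedSpace ℝ V] [FiniteDimensional ℝ V]
    (F : V → V), ContDiff ℝ ∞ F → ∀ φ : ℝ → V,
      (∀ᶠ t in 𝓝 (0 : ℝ), HasDerivAt φ (F (φ t)) t) →
      Asymptotics.IsBigO (𝓝 (0 : ℝ)) (fun h : ℝ => M.step F h (φ 0) - φ h)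
        (fun h : ℝ => h ^ (s + 1))

/-! ### The objective function -/

section Objective

variable {X : Type*} [NormedAddCommGroup X] [InnerProductSpace ℝ X]

/-- `f` is `μ`-quasi-strongly convex with minimizer `xs`:
`f(xs) ≥ f(x) + ⟪∇f(x), xs - x⟫ + μ/2 ‖x - xs‖²` for all `x`. -/
def QuasiStronglyConvex [CompleteSpace X] (f : X → ℝ) (μ : ℝ) (xs : X) : Prop :=
  (∀ x, f xs ≤ f x) ∧
    ∀ x, f x + inner ℝ (gradient f x) (xs - x) + μ / 2 * ‖x - xs‖ ^ 2 ≤ f xs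

/-- The derivatives of `f` up to order `s + 1` exist everywhere, and those of the orders
`2, …, s + 1` have operator norm at most `L`. -/
def HighOrderSmooth (f : X → ℝ) (s : ℕ) (L : ℝ) : Prop :=
  (∀ n ≤ s, Differentiable ℝ (iteratedFDeriv ℝ n f)) ∧
    ∀ n, 2 ≤ n → n ≤ s + 1 → ∀ x, ‖iteratedFDeriv ℝ n f x‖ ≤ L

/-- The rescaled heavy-ball vector field on states `y = (w, x)`, where `g` is the gradient map
and `Q = L / μ`:  `F(w, x) = (-2 w - g(x) / (μ √Q), √Q w)`. -/
def field (μ L : ℝ) (g : X → X) (y : X × X) : X × X :=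
  (-((2 : ℝ) • y.1) - (1 / (μ * √(L / μ))) • g y.2, √(L / μ) • y.1)

/-- The Lyapunov function `𝓔(w, x)`, where `Q = L / μ`. -/
def lyapunov (f : X → ℝ) (μ L : ℝ) (xs : X) (y : X × X) : ℝ :=
  2 * (f y.2 - f xs) / μ + (L / μ) / 2 * ‖y.1‖ ^ 2
    + 1 / 2 * ‖y.2 + √(L / μ) • y.1 - xs‖ ^ 2

end Objective

/-- The exponent `γ = (s + 3) / (2 (s + 1))`. -/
def gam (s : ℕ) : ℝ := ((s : ℝ) + 3) / (2 * ((s : ℝ) + 1))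

/-- The largest admissible step `max{e, Q}^{-γ} / (2 c^{1/(s+1)})`. For `e, Q > 0` this is
`min{e^{-γ}, Q^{-γ}} / (2 c^{1/(s+1)})`; for `e = 0` the first entry of the minimum counts
as `+∞`. -/
def maxStep (s : ℕ) (c e Q : ℝ) : ℝ :=
  max e Q ^ (-gam s) / (2 * c ^ (1 / ((s : ℝ) + 1)))

/-! ### Counting gradient evaluations

A program that can learn about the objective only by querying a gradient oracle `X → X`. -/

inductive GradProg (X : Type*) (α : Type*) where
  | done (r : α) : GradProg X α
  | query (x : X) (next : X → GradProg X α) : GradProg X α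

namespace GradProg

variable {X α β : Type*}

def bind : GradProg X α → (α → GradProg X β) → GradProg X β
  | done r, k => k r
  | query x next, k => query x fun v => (next v).bind k

/-- The output of a program when the oracle answers `g x` to the query `x`. -/
def eval (g : X → X) : GradProg X α → α
  | done r => r
  | query x next => (next (g x)).eval g

/-- The number of queries made in a run of a program with oracle `g`. -/
def queries (g : X → X) : GradProg X α → ℕ
  | done _ => 0
  | query x next => (next (g x)).queries g + 1

theorem eval_bind (g : X → X) (p : GradProg X α) (k : α → GradProg X β) :
    (p.bind k).eval g = (k (p.eval g)).eval g := by
  induction p with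
  | done r => rfl
  | query x next ih => exact ih (g x)

theorem queries_bind (g : X → X) (p : GradProg X α) (k : α → GradProg X β) :
    (p.bind k).queries g = p.queries g + (k (p.eval g)).queries g := by
  induction p with
  | done r => simp [bind, queries, eval]
  | query x next ih =>
    have := ih (g x)
    simp only [bind, queries, eval, this]
    omega

end GradProg

section Program

variable {X : Type*} [NormedAddCommGroup X] [InnerProductSpace ℝ X]

/-- One evaluation of the heavy-ball field, with one gradient query. -/
def fieldProg (μ L : ℝ) (y : X × X) : GradProg X (X × X) :=
  .query y.2 fun v => .done (field μ L (fun _ => v) y)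

/-- Computes the values `F(g_0), …, F(g_{i-1})` at the first `i` stages one after the other. -/
def stagesProg (M : ExplicitRK) (μ L h : ℝ) (y : X × X) : ℕ → GradProg X (ℕ → X × X)
  | 0 => .done fun _ => 0
  | i + 1 => (stagesProg M μ L h y i).bind fun k =>
      (fieldProg μ L (y + h • ∑ j ∈ Finset.range i, M.a i j • k j)).bind fun v =>
        .done (Function.update k i v)

def stepProg (M : ExplicitRK) (μ L h : ℝ) (y : X × X) : GradProg X (X × X) :=
  (stagesProg M μ L h y M.stages).bind fun k =>
    .done (y + h • ∑ i ∈ Finset.range M.stages, M.b i • k i)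

/-- The optimization algorithm: `N` integrator steps of size `h` from the state `y₀`. -/
def algorithm (M : ExplicitRK) (μ L h : ℝ) (y₀ : X × X) : ℕ → GradProg X (X × X)
  | 0 => .done y₀
  | N + 1 => (algorithm M μ L h y₀ N).bind fun y => stepProg M μ L h y

theorem stagesProg_eval (M : ExplicitRK) (μ L h : ℝ) (g : X → X) (y : X × X) (n : ℕ) :
    ∀ i < n, (stagesProg M μ L h y n).eval g i
      = field μ L g (M.stage (field μ L g) h y i) := by
  induction n with
  | zero => intro i hi; omega
  | succ n ih =>
    intro i hi
    simp only [stagesProg, GradProg.eval_bind, fieldProg, GradProg.eval]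
    by_cases hin : i = n
    · subst hin
      rw [Function.update_self, ExplicitRK.stage,
        Finset.sum_range (fun j => M.a i j • GradProg.eval g (stagesProg M μ L h y i) j)]
      have : ∀ j : Fin i, M.a i j • GradProg.eval g (stagesProg M μ L h y i) j
          = M.a i j • field μ L g (M.stage (field μ L g) h y j) :=
        fun j => by rw [ih j j.isLt]
      simp only [this, field]
    · rw [Function.update_of_ne hin]
      exact ih i (by omega)

theorem stagesProg_queries (M : ExplicitRK) (μ L h : ℝ) (g : X → X) (y : X × X) (n : ℕ) :
    (stagesProg M μ L h y n).queries g = n := by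
  induction n with
  | zero => rfl
  | succ n ih =>
    simp [stagesProg, GradProg.queries_bind, fieldProg, GradProg.queries, ih]

/-- The program computes the numerical solution. -/
theorem algorithm_eval (M : ExplicitRK) (μ L h : ℝ) (g : X → X) (y₀ : X × X) (N : ℕ) :
    (algorithm M μ L h y₀ N).eval g = M.iter (field μ L g) h y₀ N := by
  induction N with
  | zero => rfl
  | succ N ih =>
    simp only [algorithm, GradProg.eval_bind, ih, stepProg, GradProg.eval, ExplicitRK.iter,
      ExplicitRK.step]
    congr 2
    refine Finset.sum_congr rfl fun i hi => ?_
    rw [stagesProg_eval M μ L h g _ _ i (Finset.mem_range.1 hi)]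

/-- An `S`-stage integrator makes `S` gradient evaluations per step. -/
theorem algorithm_queries (M : ExplicitRK) (μ L h : ℝ) (g : X → X) (y₀ : X × X) (N : ℕ) :
    (algorithm M μ L h y₀ N).queries g = M.stages * N := by
  induction N with
  | zero => rfl
  | succ N ih =>
    simp only [algorithm, GradProg.queries_bind, ih, stepProg, GradProg.queries,
      stagesProg_queries]
    ring

end Program

end HeavyBall

end

/-! As a curve in the step size, t ↦ Φ_t(y) solves the heavy-ball system up to a residual, and the
Lyapunov function tolerates a small residual: along exact solutions 𝓔' ≤ -𝓔/2, and a residual of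
norm at most η adds at most 8 √Q √𝓔 η (`exists_hasDerivAt_lyapunov`).

The residual must be O(t^s) with a constant independent of f and d, whereas the order condition is
qualitative and concerns one smooth field at a time. The two aspects are separated. The residual has
a Taylor expansion at t = 0 whose remainder is controlled by derivative bounds of the field alone
(`ExplicitRK.exists_residual_taylorBound`). The order condition, applied to a Taylor polynomial of
the field, makes all coefficients below t^s vanish (`ExplicitRK.HasOrder.residual_coeff_eq_zero`).

Absolute derivative bounds come from rescaling around y: with E = 𝓔(y) and m ≥ max{E, Q}, the unit
of state is √E/√m and the unit of time is 1/√m (`smoothBound_rescaled_field`). In the original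
variables the residual is then at most const · √E (√m h)^s. The exponent γ keeps √m (√m h)^s below a
small constant, and a barrier argument gives the contraction in one step (`lyapunov_step_le`).
Contraction keeps the iterates in {𝓔 ≤ m}, so it can be iterated; the evaluation count follows from
2 (f - f(x*)) ≤ μ 𝓔. -/

namespace HeavyBall

/-! ### Derivative bounds and Taylor expansions with uniform constants. -/

section Calculus

variable {U V W Z : Type} [NormedAddCommGroup U] [NormedSpace ℝ U]
  [NormedAddCommGroup V] [NormedSpace ℝ V] [NormedAddCommGroup W] [NormedSpace ℝ W]
  [NormedAddCommGroup Z] [NormedSpace ℝ Z]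

/-- The map has `n` derivatives everywhere, and those of the orders `1, …, n` are bounded by
`B`. -/
def SmoothBound (B : ℝ) : ℕ → ∀ {W : Type} [NormedAddCommGroup W] [NormedSpace ℝ W],
    (V → W) → Prop
  | 0, _, _, _, _ => True
  | n + 1, _, _, _, F =>
    Differentiable ℝ F ∧ (∀ x, ‖fderiv ℝ F x‖ ≤ B) ∧ SmoothBound B n (fderiv ℝ F)

theorem SmoothBound.mono {B B' : ℝ} (hB : B ≤ B') {n : ℕ} {F : V → W} (h : SmoothBound B n F) :
    SmoothBound B' n F := by
  induction n generalizing W with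
  | zero => trivial
  | succ n ih => exact ⟨h.1, fun x => (h.2.1 x).trans hB, ih h.2.2⟩

theorem SmoothBound.add {B B' : ℝ} {n : ℕ} {F G : V → W} (hF : SmoothBound B n F)
    (hG : SmoothBound B' n G) : SmoothBound (B + B') n (fun x => F x + G x) := by
  induction n generalizing W with
  | zero => trivial
  | succ n ih =>
    have h : fderiv ℝ (fun x => F x + G x) = fun x => fderiv ℝ F x + fderiv ℝ G x :=
      funext fun x => fderiv_fun_add (hF.1 x) (hG.1 x)
    refine ⟨hF.1.add hG.1, fun x => ?_, ?_⟩
    · rw [h]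
      exact (norm_add_le _ _).trans (add_le_add (hF.2.1 x) (hG.2.1 x))
    · rw [h]
      exact ih hF.2.2 hG.2.2

theorem SmoothBound.clm_comp {B r : ℝ} {n : ℕ} {F : V → W} (hF : SmoothBound B n F)
    (l : W →L[ℝ] Z) (hl : ‖l‖ ≤ r) : SmoothBound (r * B) n (fun x => l (F x)) := by
  induction n generalizing W Z with
  | zero => trivial
  | succ n ih =>
    have h : fderiv ℝ (fun x => l (F x)) =
        fun x => ContinuousLinearMap.compL ℝ V W Z l (fderiv ℝ F x) :=
      funext fun x => (l.hasFDerivAt.comp x (hF.1 x).hasFDerivAt).fderiv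
    refine ⟨l.differentiable.comp hF.1, fun x => ?_, ?_⟩
    · rw [h]
      exact (l.opNorm_comp_le _).trans
        (mul_le_mul hl (hF.2.1 x) (norm_nonneg _) ((norm_nonneg _).trans hl))
    · rw [h]
      refine ih hF.2.2 _ (le_trans ?_ hl)
      exact ContinuousLinearMap.opNorm_le_bound _ (norm_nonneg _) fun A => l.opNorm_comp_le A

/-- The derivative of order k gains a factor r^k, which is at most r because r ≤ 1. A single factor
r is all that the rescaling of the field needs. -/
theorem SmoothBound.comp_affine {B r : ℝ} (hB : 0 ≤ B) (hr : r ≤ 1) {n : ℕ} {F : V → W}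
    (hF : SmoothBound B n F) (l : U →L[ℝ] V) (hl : ‖l‖ ≤ r) (y : V) :
    SmoothBound (r * B) n (fun x => F (y + l x)) := by
  have hr0 : 0 ≤ r := (norm_nonneg _).trans hl
  induction n generalizing W with
  | zero => trivial
  | succ n ih =>
    have h : fderiv ℝ (fun x => F (y + l x)) =
        fun x => (ContinuousLinearMap.compL ℝ U V W).flip l (fderiv ℝ F (y + l x)) :=
      funext fun x => ((hF.1 (y + l x)).hasFDerivAt.comp x (l.hasFDerivAt.const_add y)).fderiv
    refine ⟨hF.1.comp (l.differentiable.const_add y), fun x => ?_, ?_⟩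
    · rw [h, mul_comm r]
      exact ((fderiv ℝ F (y + l x)).opNorm_comp_le l).trans
        (mul_le_mul (hF.2.1 _) hl (norm_nonneg _) hB)
    · rw [h]
      have := (ih hF.2.2).clm_comp
        ((ContinuousLinearMap.compL ℝ U V W).flip l) (r := 1) ?_
      · rwa [one_mul] at this
      · refine ContinuousLinearMap.opNorm_le_bound _ zero_le_one fun A => ?_
        refine (A.opNorm_comp_le l).trans ?_
        rw [mul_comm]
        exact mul_le_mul_of_nonneg_right (hl.trans hr) (norm_nonneg _)

theorem smoothBound_const {B : ℝ} (hB : 0 ≤ B) (n : ℕ) (c : W) :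
    SmoothBound B n (fun _ : V => c) := by
  induction n generalizing W with
  | zero => trivial
  | succ n ih =>
    have h : fderiv ℝ (fun _ : V => c) = fun _ => 0 := funext fun x => by simp
    refine ⟨differentiable_const c, fun x => ?_, ?_⟩
    · rw [h]
      simpa using hB
    · rw [h]
      exact ih 0

theorem smoothBound_affine {B : ℝ} (n : ℕ) (c : W) (l : V →L[ℝ] W) (hl : ‖l‖ ≤ B) :
    SmoothBound B n (fun x => c + l x) := by
  cases n with
  | zero => trivial
  | succ n =>
    have h : fderiv ℝ (fun x => c + l x) = fun _ => l :=
      funext fun x => (l.hasFDerivAt.const_add c).fderiv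
    refine ⟨l.differentiable.const_add c, fun x => ?_, ?_⟩
    · rwa [h]
    · rw [h]
      exact smoothBound_const ((norm_nonneg _).trans hl) n l

theorem differentiable_iteratedFDeriv_fderiv {F : V → W} {i : ℕ}
    (h : Differentiable ℝ (iteratedFDeriv ℝ (i + 1) F)) :
    Differentiable ℝ (iteratedFDeriv ℝ i (fderiv ℝ F)) := by
  have key : iteratedFDeriv ℝ (i + 1) F =
      (continuousMultilinearCurryRightEquiv' ℝ i V W).symm ∘ iteratedFDeriv ℝ i (fderiv ℝ F) :=
    funext fun x => iteratedFDeriv_succ_eq_comp_right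
  rw [key] at h
  exact (LinearIsometryEquiv.comp_differentiable_iff _).1 h

theorem smoothBound_of_iteratedFDeriv {B : ℝ} {n : ℕ} {F : V → W}
    (hd : ∀ i < n, Differentiable ℝ (iteratedFDeriv ℝ i F))
    (hB : ∀ i, 1 ≤ i → i ≤ n → ∀ x, ‖iteratedFDeriv ℝ i F x‖ ≤ B) : SmoothBound B n F := by
  induction n generalizing W with
  | zero => trivial
  | succ n ih =>
    refine ⟨?_, fun x => ?_, ih (fun i hi => ?_) fun i h1 hi x => ?_⟩
    · have h := hd 0 (Nat.succ_pos n)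
      rw [iteratedFDeriv_zero_eq_comp] at h
      exact (LinearIsometryEquiv.comp_differentiable_iff _).1 h
    · have h := hB 1 le_rfl (by omega) x
      rw [← norm_iteratedFDeriv_fderiv] at h
      simpa using h
    · exact differentiable_iteratedFDeriv_fderiv (hd (i + 1) (by omega))
    · rw [norm_iteratedFDeriv_fderiv]
      exact hB (i + 1) (by omega) (by omega) x

/-- On `[0, 1]` the curve has `n` derivatives, and all those of the orders `0, …, n` are bounded
by `K`. -/
def JetBound (K : ℝ) : ℕ → (ℝ → W) → Prop
  | 0, u => ∀ t ∈ Set.Icc (0 : ℝ) 1, ‖u t‖ ≤ K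
  | n + 1, u => (∀ t ∈ Set.Icc (0 : ℝ) 1, ‖u t‖ ≤ K) ∧
      ∃ u' : ℝ → W, (∀ t ∈ Set.Icc (0 : ℝ) 1, HasDerivAt u (u' t) t) ∧ JetBound K n u'

theorem JetBound.norm_le {K : ℝ} {n : ℕ} {u : ℝ → W} (h : JetBound K n u) :
    ∀ t ∈ Set.Icc (0 : ℝ) 1, ‖u t‖ ≤ K := by
  cases n with
  | zero => exact h
  | succ n => exact h.1

theorem JetBound.nonneg {K : ℝ} {n : ℕ} {u : ℝ → W} (h : JetBound K n u) : 0 ≤ K :=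
  (norm_nonneg _).trans (h.norm_le 0 (by simp))

theorem JetBound.mono {K K' : ℝ} (hK : K ≤ K') {n : ℕ} {u : ℝ → W} (h : JetBound K n u) :
    JetBound K' n u := by
  induction n generalizing u with
  | zero => exact fun t ht => (h t ht).trans hK
  | succ n ih =>
    obtain ⟨h1, u', h2, h3⟩ := h
    exact ⟨fun t ht => (h1 t ht).trans hK, u', h2, ih h3⟩

theorem JetBound.of_succ {K : ℝ} {n : ℕ} {u : ℝ → W} (h : JetBound K (n + 1) u) :
    JetBound K n u := by
  induction n generalizing u with
  | zero => exact h.1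
  | succ n ih =>
    obtain ⟨h1, u', h2, h3⟩ := h
    exact ⟨h1, u', h2, ih h3⟩

theorem JetBound.add {K K' : ℝ} {n : ℕ} {u v : ℝ → W} (hu : JetBound K n u)
    (hv : JetBound K' n v) : JetBound (K + K') n (fun t => u t + v t) := by
  induction n generalizing u v with
  | zero => exact fun t ht => (norm_add_le _ _).trans (add_le_add (hu t ht) (hv t ht))
  | succ n ih =>
    obtain ⟨h1, u', h2, h3⟩ := hu
    obtain ⟨g1, v', g2, g3⟩ := hv
    exact ⟨fun t ht => (norm_add_le _ _).trans (add_le_add (h1 t ht) (g1 t ht)), _,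
      fun t ht => (h2 t ht).add (g2 t ht), ih h3 g3⟩

theorem jetBound_const (n : ℕ) (c : W) : JetBound ‖c‖ n (fun _ => c) := by
  have zero : ∀ n, JetBound ‖c‖ n (fun _ => (0 : W)) := by
    intro n
    induction n with
    | zero => exact fun t _ => by simp
    | succ n ih => exact ⟨fun t _ => by simp, _, fun t _ => hasDerivAt_const t _, ih⟩
  cases n with
  | zero => exact fun t _ => le_rfl
  | succ n => exact ⟨fun t _ => le_rfl, _, fun t _ => hasDerivAt_const t _, zero n⟩

theorem jetBound_id (n : ℕ) : JetBound 1 n (fun t : ℝ => t) := by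
  have h0 : ∀ t ∈ Set.Icc (0 : ℝ) 1, ‖t‖ ≤ 1 := fun t ht => by
    rw [Real.norm_eq_abs, abs_le]
    constructor <;> linarith [ht.1, ht.2]
  cases n with
  | zero => exact h0
  | succ n =>
    refine ⟨h0, _, fun t _ => hasDerivAt_id t, ?_⟩
    simpa using jetBound_const n (1 : ℝ)

theorem JetBound.bilin {K K' : ℝ} {n : ℕ} {u : ℝ → V} {v : ℝ → W} (hu : JetBound K n u)
    (hv : JetBound K' n v) (l : V →L[ℝ] W →L[ℝ] Z) (hl : ‖l‖ ≤ 1) :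
    JetBound (2 ^ n * (K * K')) n (fun t => l (u t) (v t)) := by
  have hK := hu.nonneg
  have hK' := hv.nonneg
  have h0 : ∀ t ∈ Set.Icc (0 : ℝ) 1, ‖l (u t) (v t)‖ ≤ K * K' := fun t ht => by
    refine (l.le_opNorm₂ _ _).trans ?_
    have := mul_le_mul hl (hu.norm_le t ht) (norm_nonneg _) zero_le_one
    rw [one_mul] at this
    exact mul_le_mul this (hv.norm_le t ht) (norm_nonneg _) hK
  induction n generalizing u v with
  | zero => simpa [JetBound] using h0
  | succ n ih =>
    have hu0 := hu.of_succ
    have hv0 := hv.of_succ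
    obtain ⟨h1, u', h2, h3⟩ := hu
    obtain ⟨g1, v', g2, g3⟩ := hv
    refine ⟨fun t ht => (h0 t ht).trans ?_, fun t => l (u t) (v' t) + l (u' t) (v t),
      fun t ht => ?_, ?_⟩
    · exact le_mul_of_one_le_left (mul_nonneg hK hK') (one_le_pow₀ one_le_two)
    · have := l.hasFDerivAt_of_bilinear (h2 t ht).hasFDerivAt (g2 t ht).hasFDerivAt
      have := this.hasDerivAt
      simpa using this
    -- The induction hypothesis also asks for the pointwise bound, here for the pairs (u, v') and
    -- (u', v).
    · have bd : ∀ {u : ℝ → V} {v : ℝ → W}, JetBound K n u → JetBound K' n v →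
          ∀ t ∈ Set.Icc (0 : ℝ) 1, ‖l (u t) (v t)‖ ≤ K * K' := fun {u v} hu hv t ht => by
        refine (l.le_opNorm₂ _ _).trans ?_
        have := mul_le_mul hl (hu.norm_le t ht) (norm_nonneg _) zero_le_one
        rw [one_mul] at this
        exact mul_le_mul this (hv.norm_le t ht) (norm_nonneg _) hK
      refine ((ih hu0 g3 (bd hu0 g3)).add (ih h3 hv0 (bd h3 hv0))).mono (le_of_eq ?_)
      ring

theorem JetBound.smul {K K' : ℝ} {n : ℕ} {u : ℝ → ℝ} {v : ℝ → W} (hu : JetBound K n u)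
    (hv : JetBound K' n v) : JetBound (2 ^ n * (K * K')) n (fun t => u t • v t) :=
  hu.bilin hv (ContinuousLinearMap.lsmul ℝ ℝ) ContinuousLinearMap.opNorm_lsmul_le

theorem exists_jetBound_sum (n m : ℕ) (a : Fin m → ℝ) (K : Fin m → ℝ) :
    ∃ K' : ℝ, ∀ {W : Type} [NormedAddCommGroup W] [NormedSpace ℝ W] (u : Fin m → ℝ → W),
      (∀ j, JetBound (K j) n (u j)) → JetBound K' n (fun t => ∑ j, a j • u j t) := by
  induction m with
  | zero => exact ⟨0, fun {W} _ _ u _ => by simpa using jetBound_const n (0 : W)⟩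
  | succ m ih =>
    obtain ⟨K', hK'⟩ := ih (fun j => a j.castSucc) (fun j => K j.castSucc)
    refine ⟨K' + 2 ^ n * (‖a (Fin.last m)‖ * K (Fin.last m)), fun u hu => ?_⟩
    simp only [Fin.sum_univ_castSucc]
    exact (hK' (fun j => u j.castSucc) fun j => hu _).add
      ((jetBound_const n (a (Fin.last m))).smul (hu _))

/-- By the chain rule the derivative is F'(u) u': induction treats F' ∘ u, and `JetBound.bilin` the
product. Values of F need a separate hypothesis, since `SmoothBound` controls derivatives only. The
constant is chosen before the spaces and maps, which is the uniformity in f and d. -/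
theorem exists_jetBound_comp (n : ℕ) (B K : ℝ) :
    ∃ K' : ℝ, ∀ {V W : Type} [NormedAddCommGroup V] [NormedSpace ℝ V] [NormedAddCommGroup W]
      [NormedSpace ℝ W] (F : V → W) (u : ℝ → V), SmoothBound B n F → JetBound K n u →
      (∀ t ∈ Set.Icc (0 : ℝ) 1, ‖F (u t)‖ ≤ K) → JetBound K' n (fun t => F (u t)) := by
  induction n generalizing K with
  | zero => exact ⟨K, fun F u _ _ h => h⟩
  | succ n ih =>
    obtain ⟨K₁, hK₁⟩ := ih (max B K)
    refine ⟨max K (2 ^ n * (K₁ * K)), fun F u hF hu h => ?_⟩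
    have hu0 := hu.of_succ
    obtain ⟨h1, u', h2, h3⟩ := hu
    refine ⟨fun t ht => (h t ht).trans (le_max_left _ _), fun t => fderiv ℝ F (u t) (u' t),
      fun t ht => (hF.1 (u t)).hasFDerivAt.comp_hasDerivAt t (h2 t ht), ?_⟩
    refine JetBound.mono (le_max_right _ _) ?_
    exact (hK₁ (fderiv ℝ F) u hF.2.2 (hu0.mono (le_max_right _ _))
      fun t _ => (hF.2.1 _).trans (le_max_left _ _)).bilin h3
        (ContinuousLinearMap.id ℝ _) ContinuousLinearMap.norm_id_le

theorem hasDerivAt_pow_succ_smul (j : ℕ) (c : W) (x : ℝ) :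
    HasDerivAt (fun t : ℝ => t ^ (j + 1) • ((j : ℝ) + 1)⁻¹ • c) (x ^ j • c) x := by
  refine ((hasDerivAt_pow (j + 1) x).smul_const (((j : ℝ) + 1)⁻¹ • c)).congr_deriv ?_
  have hj : (j : ℝ) + 1 ≠ 0 := by positivity
  rw [smul_smul]
  congr 1
  push_cast
  field_simp

/-- On `[0, 1]` the curve agrees with a polynomial of degree less than `n` up to an error of at
most `C t ^ n`. -/
def TaylorBound (C : ℝ) (n : ℕ) (u : ℝ → W) : Prop :=
  ∃ c : ℕ → W, ∀ t ∈ Set.Icc (0 : ℝ) 1, ‖u t - ∑ j ∈ Finset.range n, t ^ j • c j‖ ≤ C * t ^ n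

theorem JetBound.taylorBound {K : ℝ} {n : ℕ} {u : ℝ → W} (h : JetBound K n u) :
    TaylorBound K n u := by
  induction n generalizing u with
  | zero => exact ⟨fun _ => 0, fun t ht => by simpa using h t ht⟩
  | succ n ih =>
    have hK := h.nonneg
    obtain ⟨-, u', h2, h3⟩ := h
    obtain ⟨c, hc⟩ := ih h3
    -- The polynomial of u' is integrated term by term, with constant term u(0).
    refine ⟨fun j => Nat.casesOn j (u 0) fun i => ((i : ℝ) + 1)⁻¹ • c i, fun t ht => ?_⟩
    set p : ℝ → W := fun t =>
      u t - ∑ j ∈ Finset.range n, t ^ (j + 1) • ((j : ℝ) + 1)⁻¹ • c j with hp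
    have hd : ∀ x ∈ Set.Icc (0 : ℝ) t,
        HasDerivWithinAt p (u' x - ∑ j ∈ Finset.range n, x ^ j • c j) (Set.Icc 0 t) x := by
      intro x hx
      refine ((h2 x ⟨hx.1, hx.2.trans ht.2⟩).sub
        (HasDerivAt.fun_sum fun j _ => hasDerivAt_pow_succ_smul j (c j) x)).hasDerivWithinAt
    have := norm_image_sub_le_of_norm_deriv_le_segment' hd (C := K * t ^ n) (fun x hx =>
      (hc x ⟨hx.1, hx.2.le.trans ht.2⟩).trans
        (mul_le_mul_of_nonneg_left (pow_le_pow_left₀ hx.1 hx.2.le n) hK)) t ⟨ht.1, le_rfl⟩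
    have hp0 : p 0 = u 0 := by simp [hp]
    rw [hp0, sub_zero] at this
    rw [Finset.sum_range_succ']
    calc _ = ‖p t - u 0‖ := by simp [hp, sub_sub]
      _ ≤ K * t ^ n * t := this
      _ = K * t ^ (n + 1) := by ring

theorem TaylorBound.add {C C' : ℝ} {n : ℕ} {u v : ℝ → W} (hu : TaylorBound C n u)
    (hv : TaylorBound C' n v) : TaylorBound (C + C') n (fun t => u t + v t) := by
  obtain ⟨c, hc⟩ := hu
  obtain ⟨d, hd⟩ := hv
  refine ⟨fun j => c j + d j, fun t ht => ?_⟩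
  calc _ = ‖(u t - ∑ j ∈ Finset.range n, t ^ j • c j)
          + (v t - ∑ j ∈ Finset.range n, t ^ j • d j)‖ := by
        simp only [smul_add, Finset.sum_add_distrib]
        congr 1
        abel
    _ ≤ _ := (norm_add_le _ _).trans (by linarith [hc t ht, hd t ht])

theorem TaylorBound.neg {C : ℝ} {n : ℕ} {u : ℝ → W} (hu : TaylorBound C n u) :
    TaylorBound C n (fun t => -u t) := by
  obtain ⟨c, hc⟩ := hu
  refine ⟨fun j => -c j, fun t ht => ?_⟩
  rw [← norm_neg]
  refine le_trans (le_of_eq ?_) (hc t ht)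
  congr 1
  simp only [smul_neg, Finset.sum_neg_distrib]
  abel

/-- The factor t wins back the order that is lost when a curve is differentiated. -/
theorem TaylorBound.id_smul {C : ℝ} {n : ℕ} {u : ℝ → W} (hu : TaylorBound C n u) :
    TaylorBound C (n + 1) (fun t => t • u t) := by
  obtain ⟨c, hc⟩ := hu
  refine ⟨fun j => Nat.casesOn j 0 c, fun t ht => ?_⟩
  calc _ = ‖t • (u t - ∑ j ∈ Finset.range n, t ^ j • c j)‖ := by
        rw [Finset.sum_range_succ']
        simp [smul_sub, Finset.smul_sum, smul_smul, pow_succ']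
    _ = t * ‖u t - ∑ j ∈ Finset.range n, t ^ j • c j‖ := by
        rw [norm_smul, Real.norm_of_nonneg ht.1]
    _ ≤ t * (C * t ^ n) := mul_le_mul_of_nonneg_left (hc t ht) ht.1
    _ = C * t ^ (n + 1) := by ring

/-- A map with `n` bounded derivatives has a Taylor polynomial at `0`, written as a sum of
homogeneous maps. -/
theorem SmoothBound.exists_homogeneous {B : ℝ} (hB : 0 ≤ B) {n : ℕ} {F : V → W}
    (hF : SmoothBound B n F) (h0 : n = 0 → ∀ z, ‖F z‖ ≤ B) :
    ∃ p : ℕ → V → W, (∀ j, ContDiff ℝ ∞ (p j)) ∧ (∀ j (t : ℝ) z, p j (t • z) = t ^ j • p j z) ∧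
      ∀ z, ‖F z - ∑ j ∈ Finset.range n, p j z‖ ≤ B * ‖z‖ ^ n := by
  induction n generalizing W with
  | zero => exact ⟨fun _ _ => 0, fun _ => contDiff_const, by simp, by simpa using h0⟩
  | succ n ih =>
    obtain ⟨p, hp, hh, hr⟩ := ih hF.2.2 fun _ => hF.2.1
    -- The expansion of F' is integrated along the ray from 0 to z; homogeneity reduces this to
    -- integrating powers of t.
    refine ⟨fun j => Nat.casesOn j (fun _ => F 0) fun i z => ((i : ℝ) + 1)⁻¹ • p i z z,
      fun j => ?_, fun j t z => ?_, fun z => ?_⟩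
    · cases j with
      | zero => exact contDiff_const
      | succ i => exact ((hp i).clm_apply contDiff_id).const_smul (((i : ℝ) + 1)⁻¹)
    · cases j with
      | zero => simp
      | succ i =>
        simp only [hh, map_smul, smul_apply, smul_smul]
        congr 1
        ring
    · rw [Finset.sum_range_succ']
      set q : ℝ → W := fun t => F (t • z) -
        ∑ j ∈ Finset.range n, t ^ (j + 1) • ((j : ℝ) + 1)⁻¹ • p j z z with hq
      have hd : ∀ x ∈ Set.Icc (0 : ℝ) 1, HasDerivWithinAt q
          ((fderiv ℝ F (x • z) - ∑ j ∈ Finset.range n, p j (x • z)) z) (Set.Icc 0 1) x := by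
        intro x hx
        have h1 : HasDerivAt (fun t : ℝ => F (t • z)) (fderiv ℝ F (x • z) z) x := by
          have := (hF.1 (x • z)).hasFDerivAt.comp_hasDerivAt x
            ((hasDerivAt_id x).smul_const z)
          simpa [Function.comp_def] using this
        have h2 : HasDerivAt (fun t : ℝ => ∑ j ∈ Finset.range n,
            t ^ (j + 1) • ((j : ℝ) + 1)⁻¹ • p j z z)
            (∑ j ∈ Finset.range n, x ^ j • p j z z) x :=
          HasDerivAt.fun_sum fun j _ => hasDerivAt_pow_succ_smul j (p j z z) x
        refine ((h1.sub h2).congr_deriv ?_).hasDerivWithinAt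
        simp [hh]
      have := norm_image_sub_le_of_norm_deriv_le_segment_01' hd (C := B * ‖z‖ ^ n * ‖z‖)
        fun x hx => by
          refine (ContinuousLinearMap.le_opNorm _ _).trans
            (mul_le_mul_of_nonneg_right ((hr _).trans ?_) (norm_nonneg z))
          refine mul_le_mul_of_nonneg_left (pow_le_pow_left₀ (norm_nonneg _) ?_ n) hB
          rw [norm_smul, Real.norm_of_nonneg hx.1]
          exact mul_le_of_le_one_left (norm_nonneg _) hx.2.le
      calc _ = ‖q 1 - q 0‖ := by
            simp [hq, sub_sub]
        _ ≤ _ := this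
        _ = _ := by ring

/-- The order condition covers smooth fields only, so a field of finite regularity is replaced by
its Taylor polynomial. -/
theorem SmoothBound.exists_contDiff {B : ℝ} (hB : 0 ≤ B) {n : ℕ} (hn : n ≠ 0) {F : V → W}
    (hF : SmoothBound B n F) :
    ∃ P : V → W, ContDiff ℝ ∞ P ∧ ∀ z, ‖F z - P z‖ ≤ B * ‖z‖ ^ n := by
  obtain ⟨p, hp, -, hr⟩ := hF.exists_homogeneous hB fun h => absurd h hn
  exact ⟨_, ContDiff.sum fun j _ => hp j, hr⟩

end Calculus

end HeavyBall

namespace HeavyBall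

/-! ### Stages of the integrator: scaling, derivative bounds, residual of the step curve. -/

section RungeKutta

theorem SmoothBound.norm_sub_le {V W : Type} [NormedAddCommGroup V] [NormedSpace ℝ V]
    [NormedAddCommGroup W] [NormedSpace ℝ W] {B : ℝ} {n : ℕ} (hn : n ≠ 0) {F : V → W}
    (hF : SmoothBound B n F) (y z : V) : ‖F z - F y‖ ≤ B * ‖z - y‖ := by
  obtain ⟨n, rfl⟩ := Nat.exists_eq_succ_of_ne_zero hn
  exact convex_univ.norm_image_sub_le_of_norm_fderiv_le (fun x _ => hF.1 x)
    (fun x _ => hF.2.1 x) (Set.mem_univ _) (Set.mem_univ _)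

/-- The integrator whose stage with the index `M.stages` is the step of `M`. -/
def ExplicitRK.augment (M : ExplicitRK) : ExplicitRK :=
  { M with a := Function.update M.a M.stages M.b }

theorem ExplicitRK.stage_augment {V : Type*} [AddCommGroup V] [Module ℝ V] (M : ExplicitRK)
    (F : V → V) (h : ℝ) (y : V) (i : ℕ) (hi : i < M.stages) :
    M.augment.stage F h y i = M.stage F h y i := by
  induction i using Nat.strong_induction_on with
  | _ i ih =>
    rw [ExplicitRK.stage, ExplicitRK.stage]
    congr 2
    refine Finset.sum_congr rfl fun j _ => ?_
    rw [ih j j.isLt (j.isLt.trans hi)]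
    simp [augment, Function.update_of_ne hi.ne]

theorem ExplicitRK.augment_stage_stages {V : Type*} [AddCommGroup V] [Module ℝ V]
    (M : ExplicitRK) (F : V → V) (h : ℝ) (y : V) :
    M.augment.stage F h y M.stages = M.step F h y := by
  rw [ExplicitRK.stage, ExplicitRK.step, Finset.sum_range]
  congr 2
  refine Finset.sum_congr rfl fun j _ => ?_
  rw [M.stage_augment F h y j j.isLt]
  simp [augment]

/-- Runge–Kutta methods commute with affine changes of state and with changes of the time unit; `hG`
says that G is F in the state z = (· - y)/δ and in the time unit τ. -/
theorem ExplicitRK.stage_affine {V : Type*} [AddCommGroup V] [Module ℝ V] (M : ExplicitRK)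
    {F G : V → V} {τ δ : ℝ} {y : V} (hG : ∀ z, τ • F (y + δ • z) = δ • G z) (h : ℝ) (i : ℕ) :
    M.stage F (τ * h) y i = y + δ • M.stage G h 0 i := by
  induction i using Nat.strong_induction_on with
  | _ i ih =>
    rw [ExplicitRK.stage, ExplicitRK.stage, zero_add, smul_comm δ h, Finset.smul_sum,
      Finset.smul_sum, Finset.smul_sum]
    congr 1
    refine Finset.sum_congr rfl fun j _ => ?_
    rw [ih j j.isLt, smul_comm δ, ← hG]
    module

theorem ExplicitRK.step_affine {V : Type*} [AddCommGroup V] [Module ℝ V] (M : ExplicitRK)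
    {F G : V → V} {τ δ : ℝ} {y : V} (hG : ∀ z, τ • F (y + δ • z) = δ • G z) (h : ℝ) :
    M.step F (τ * h) y = y + δ • M.step G h 0 := by
  rw [← augment_stage_stages, ← augment_stage_stages, stage_affine _ hG]

theorem ExplicitRK.stage_of_eq_zero {V : Type*} [AddCommGroup V] [Module ℝ V] (M : ExplicitRK)
    {F : V → V} {y : V} (hy : F y = 0) (h : ℝ) (i : ℕ) : M.stage F h y i = y := by
  induction i using Nat.strong_induction_on with
  | _ i ih =>
    rw [ExplicitRK.stage, Finset.sum_eq_zero fun j _ => ?_, smul_zero, add_zero]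
    rw [ih j j.isLt, hy, smul_zero]

theorem ExplicitRK.step_of_eq_zero {V : Type*} [AddCommGroup V] [Module ℝ V] (M : ExplicitRK)
    {F : V → V} {y : V} (hy : F y = 0) (h : ℝ) : M.step F h y = y := by
  rw [← augment_stage_stages, stage_of_eq_zero _ hy]

/-- Each stage is t times a combination of earlier field values, so the bounds pass from stage to
stage through sums, products and composition with F. The combination is bounded separately because,
for the augmented integrator, it is the increment Φ_t/t of the step. -/
theorem ExplicitRK.exists_jetBound_stage (M : ExplicitRK) {n : ℕ} (hn : n ≠ 0) (B : ℝ) (i : ℕ) :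
    ∃ K : ℝ, ∀ {V : Type} [NormedAddCommGroup V] [NormedSpace ℝ V] (F : V → V),
      SmoothBound B n F → ‖F 0‖ ≤ B →
      JetBound K n (fun t => ∑ j : Fin i, M.a i j • F (M.stage F t 0 j)) ∧
        JetBound K n (fun t => F (M.stage F t 0 i)) := by
  induction i using Nat.strong_induction_on with
  | _ i ih =>
    choose K hK using ih
    obtain ⟨K₁, hK₁⟩ := exists_jetBound_sum n i (fun j => M.a i j) (fun j => K j j.isLt)
    set K₂ : ℝ := 2 ^ n * (1 * K₁)
    obtain ⟨K₃, hK₃⟩ := exists_jetBound_comp n B (max K₂ (B + B * K₂))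
    refine ⟨max K₁ K₃, fun F hF h0 => ?_⟩
    have hB : 0 ≤ B := (norm_nonneg _).trans h0
    have hs : JetBound K₁ n (fun t => ∑ j : Fin i, M.a i j • F (M.stage F t 0 j)) :=
      hK₁ _ fun j => (hK j j.isLt F hF h0).2
    have hg : JetBound K₂ n (fun t => M.stage F t 0 i) := by
      have := (jetBound_id n).smul hs
      convert this using 2
      rw [ExplicitRK.stage, zero_add]
    refine ⟨hs.mono (le_max_left _ _), JetBound.mono (le_max_right _ _) ?_⟩
    refine hK₃ F _ hF (hg.mono (le_max_left _ _)) fun t ht => le_trans ?_ (le_max_right _ _)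
    have h1 := hF.norm_sub_le hn 0 (M.stage F t 0 i)
    rw [sub_zero] at h1
    have h2 := mul_le_mul_of_nonneg_left (hg.norm_le t ht) hB
    have h3 := norm_le_norm_add_norm_sub' (F (M.stage F t 0 i)) (F 0)
    linarith

/-- With Φ_t = t k(t) the residual is k + t k' - F(Φ_t). Here k' has only n - 1 controlled
derivatives, but the factor t restores the order n, so n derivatives of F suffice. -/
theorem ExplicitRK.exists_residual_taylorBound (M : ExplicitRK) {n : ℕ} (hn : n ≠ 0) (B : ℝ) :
    ∃ C : ℝ, ∀ {V : Type} [NormedAddCommGroup V] [NormedSpace ℝ V] (F : V → V),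
      SmoothBound B n F → ‖F 0‖ ≤ B → ∃ ρ : ℝ → V, TaylorBound C n ρ ∧
        ∀ t ∈ Set.Icc (0 : ℝ) 1,
          HasDerivAt (fun t => M.step F t 0) (F (M.step F t 0) + ρ t) t := by
  obtain ⟨n, rfl⟩ := Nat.exists_eq_succ_of_ne_zero hn
  obtain ⟨K, hK⟩ := M.augment.exists_jetBound_stage hn B M.stages
  refine ⟨K + K + K, fun F hF h0 => ?_⟩
  obtain ⟨hs, hΦ⟩ := hK F hF h0
  set k := fun t => ∑ j : Fin M.stages, M.augment.a M.stages j • F (M.augment.stage F t 0 j)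
  have hk := hs
  obtain ⟨-, k', hk', hj⟩ := hk
  simp only [augment_stage_stages] at hΦ
  refine ⟨_, (hs.taylorBound.add hj.taylorBound.id_smul).add hΦ.taylorBound.neg, fun t ht => ?_⟩
  have h1 : (fun t => M.step F t 0) = fun t => t • k t := by
    funext t
    rw [← augment_stage_stages, ExplicitRK.stage, zero_add]
  have h2 := (hasDerivAt_id t).smul (hk' t ht)
  rw [h1]
  refine h2.congr_deriv ?_
  simp only [id]
  module

end RungeKutta

end HeavyBall

namespace HeavyBall

/-! ### From the qualitative order condition to a uniform residual bound. -/

section Order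

open Asymptotics Filter

theorem eq_zero_of_sum_pow_smul_isBigO {V : Type*} [NormedAddCommGroup V] [NormedSpace ℝ V]
    {n : ℕ} {d : ℕ → V}
    (h : (fun t : ℝ => ∑ j ∈ Finset.range n, t ^ j • d j) =O[𝓝[>] 0] fun t => t ^ n) :
    ∀ j < n, d j = 0 := by
  induction n generalizing d with
  | zero => intro j hj; omega
  | succ n ih =>
    have h0 : d 0 = 0 := by
      have h1 : Tendsto (fun t : ℝ => ∑ j ∈ Finset.range (n + 1), t ^ j • d j) (𝓝[>] 0)
          (𝓝 (∑ j ∈ Finset.range (n + 1), (0 : ℝ) ^ j • d j)) :=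
        ((continuous_finsetSum _ fun j _ =>
          (continuous_pow j).smul continuous_const).tendsto 0).mono_left nhdsWithin_le_nhds
      have h2 : Tendsto (fun t : ℝ => ∑ j ∈ Finset.range (n + 1), t ^ j • d j) (𝓝[>] 0)
          (𝓝 0) := by
        refine h.trans_tendsto ?_
        have := ((continuous_pow (n + 1)).tendsto (0 : ℝ)).mono_left
          (nhdsWithin_le_nhds (s := Set.Ioi 0))
        simpa using this
      have := tendsto_nhds_unique h1 h2
      rw [Finset.sum_range_succ'] at this
      simpa using this
    have hn : ∀ j < n, d (j + 1) = 0 := by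
      refine ih ?_
      have h3 : (fun t : ℝ => t⁻¹ • ∑ j ∈ Finset.range (n + 1), t ^ j • d j) =O[𝓝[>] 0]
          fun t => t⁻¹ • t ^ (n + 1) := (isBigO_refl _ _).smul h
      refine h3.congr' ?_ ?_
      · filter_upwards [self_mem_nhdsWithin] with t (ht : 0 < t)
        rw [Finset.sum_range_succ', h0, smul_zero, add_zero, Finset.smul_sum]
        refine Finset.sum_congr rfl fun j _ => ?_
        rw [smul_smul]
        congr 1
        field_simp
        ring
      · filter_upwards [self_mem_nhdsWithin] with t (ht : 0 < t)
        simp only [smul_eq_mul]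
        field_simp
        ring
    intro j hj
    cases j with
    | zero => exact h0
    | succ j => exact hn j (by omega)

theorem isBigO_pow_succ (n : ℕ) : (fun h : ℝ => h ^ (n + 1)) =O[𝓝 0] fun h => h ^ n := by
  have h := (isBigO_refl (fun h : ℝ => h ^ n) (𝓝 0)).mul
    ((continuous_id.tendsto (0 : ℝ)).isBigO_one ℝ)
  simpa [pow_succ] using h

variable {V : Type} [NormedAddCommGroup V] [NormedSpace ℝ V]

theorem ExplicitRK.stage_isBigO (M : ExplicitRK) {F : V → V} (hF : ContinuousAt F 0) (i : ℕ) :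
    (fun h : ℝ => M.stage F h 0 i) =O[𝓝 0] fun h => h := by
  induction i using Nat.strong_induction_on with
  | _ i ih =>
    have hk : (fun h : ℝ => ∑ j : Fin i, M.a i j • F (M.stage F h 0 j)) =O[𝓝 0]
        fun _ => (1 : ℝ) := by
      refine IsBigO.fun_sum fun j _ => IsBigO.const_smul_left (E' := V) ?_ (M.a i j)
      have : Tendsto (fun h : ℝ => M.stage F h 0 j) (𝓝 0) (𝓝 0) :=
        (ih j j.isLt).trans_tendsto tendsto_id
      exact (hF.tendsto.comp this).isBigO_one ℝ
    have := (isBigO_refl (fun h : ℝ => h) (𝓝 0)).smul hk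
    simp only [smul_eq_mul, mul_one] at this
    refine this.congr_left fun h => ?_
    rw [ExplicitRK.stage, zero_add]

theorem ContDiffAt.comp_sub_comp_isBigO {P : V → V} {z : V} (hP : ContDiffAt ℝ 1 P z)
    {l : Filter ℝ} {u v : ℝ → V} (hu : Tendsto u l (𝓝 z)) (hv : Tendsto v l (𝓝 z)) :
    (fun h => P (u h) - P (v h)) =O[l] fun h => u h - v h := by
  obtain ⟨K, t, ht, hK⟩ := hP.exists_lipschitzOnWith
  refine IsBigO.of_bound K ?_
  filter_upwards [hu ht, hv ht] with h h1 h2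
  exact hK.norm_sub_le h1 h2

/-- Stages have size O(h), where F and P differ by O(h^n); P is locally Lipschitz, which carries the
differences of earlier stages along. The factor h before the sum gives the extra power. -/
theorem ExplicitRK.stage_sub_stage_isBigO (M : ExplicitRK) {F P : V → V} {n : ℕ} {B : ℝ}
    (hF : ContinuousAt F 0) (hP : ContDiffAt ℝ 1 P 0) (hFP : ∀ z, ‖F z - P z‖ ≤ B * ‖z‖ ^ n)
    (i : ℕ) :
    (fun h : ℝ => M.stage F h 0 i - M.stage P h 0 i) =O[𝓝 0] fun h => h ^ (n + 1) := by
  induction i using Nat.strong_induction_on with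
  | _ i ih =>
    have hk : (fun h : ℝ => ∑ j : Fin i, M.a i j •
        (F (M.stage F h 0 j) - P (M.stage P h 0 j))) =O[𝓝 0] fun h => h ^ n := by
      refine IsBigO.fun_sum fun j _ => IsBigO.const_smul_left (E' := V) ?_ (M.a i j)
      have h1 := M.stage_isBigO hF j
      have h2 := M.stage_isBigO hP.continuousAt j
      have h3 : (fun h : ℝ => F (M.stage F h 0 j) - P (M.stage F h 0 j)) =O[𝓝 0]
          fun h => h ^ n := by
        refine IsBigO.trans (IsBigO.of_bound B (Eventually.of_forall fun h => ?_))
          (h1.norm_left.pow n)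
        simpa using hFP _
      have h4 := ContDiffAt.comp_sub_comp_isBigO hP (h1.trans_tendsto tendsto_id)
        (h2.trans_tendsto tendsto_id)
      have h5 : (fun h : ℝ => h ^ (n + 1)) =O[𝓝 0] fun h => h ^ n :=
        isBigO_pow_succ n
      refine (h3.add ((h4.trans (ih j j.isLt)).trans h5)).congr_left fun h => ?_
      abel
    have := (isBigO_refl (fun h : ℝ => h) (𝓝 0)).smul hk
    refine this.congr (fun h => ?_) fun h => ?_
    · rw [ExplicitRK.stage, ExplicitRK.stage, zero_add, zero_add, ← smul_sub,
        ← Finset.sum_sub_distrib]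
      simp only [smul_sub]
    · simp [pow_succ']

/-- Let φ solve the system of the Taylor polynomial P of F. The order condition for P and the
closeness of the two numerical steps give Φ_t - φ(t) = O(t^{s+1}). On the other hand its derivative
is ∑ c_j t^j + O(t^s); integrating and comparing powers of t forces c_j = 0. -/
theorem ExplicitRK.HasOrder.residual_coeff_eq_zero {M : ExplicitRK} {s : ℕ} (hM : M.HasOrder s)
    (hs : s ≠ 0) [FiniteDimensional ℝ V] {F : V → V} {B : ℝ} (hB : 0 ≤ B)
    (hF : SmoothBound B s F) {ρ : ℝ → V} {C : ℝ} {c : ℕ → V}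
    (hc : ∀ t ∈ Set.Icc (0 : ℝ) 1,
      ‖ρ t - ∑ j ∈ Finset.range s, t ^ j • c j‖ ≤ C * t ^ s)
    (hρ : ∀ t ∈ Set.Icc (0 : ℝ) 1,
      HasDerivAt (fun t => M.step F t 0) (F (M.step F t 0) + ρ t) t) :
    ∀ j < s, c j = 0 := by
  obtain ⟨P, hP, hFP⟩ := hF.exists_contDiff hB hs
  have hP1 : ContDiffAt ℝ 1 P 0 := (hP.of_le (by exact_mod_cast le_top)).contDiffAt
  have hF0 : ContinuousAt F 0 := by
    obtain ⟨n, rfl⟩ := Nat.exists_eq_succ_of_ne_zero hs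
    exact hF.1.continuous.continuousAt
  have : CompleteSpace V := FiniteDimensional.complete ℝ V
  obtain ⟨r, hr, ε, hε, hsol⟩ :=
    hP1.exists_forall_mem_closedBall_exists_eq_forall_mem_Ioo_hasDerivAt 0
  obtain ⟨φ, hφ0, hφ⟩ := hsol 0 (Metric.mem_closedBall_self hr.le)
  have hφ' : ∀ᶠ t in 𝓝 (0 : ℝ), HasDerivAt φ (P (φ t)) t := by
    filter_upwards [Ioo_mem_nhds (by linarith : 0 - ε < (0 : ℝ)) (by linarith : (0 : ℝ) < 0 + ε)]
      with t ht using hφ t ht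
  have hΨ := hM V P hP φ hφ'
  rw [hφ0] at hΨ
  have hΦΨ := M.augment.stage_sub_stage_isBigO hF0 hP1 hFP M.stages
  have hΦ0 := M.augment.stage_isBigO hF0 M.stages
  simp only [augment_stage_stages] at hΦΨ hΦ0
  have hΔ : (fun h : ℝ => M.step F h 0 - φ h) =O[𝓝 0] fun h => h ^ (s + 1) :=
    (hΦΨ.add hΨ).congr_left fun h => by abel
  have hpow : (fun h : ℝ => h ^ (s + 1)) =O[𝓝 0] fun h => h ^ s :=
    isBigO_pow_succ s
  have hΦt : Tendsto (fun h : ℝ => M.step F h 0) (𝓝 0) (𝓝 0) := hΦ0.trans_tendsto tendsto_id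
  have hφt : Tendsto φ (𝓝 0) (𝓝 0) := by
    have := (hφ'.self_of_nhds).continuousAt.tendsto
    rwa [hφ0] at this
  have h1 : (fun h : ℝ => ρ h - ∑ j ∈ Finset.range s, h ^ j • c j) =O[𝓝[≥] 0]
      fun h => h ^ s := by
    refine IsBigO.of_bound C ?_
    filter_upwards [Icc_mem_nhdsGE (zero_lt_one' ℝ)] with t ht
    rw [norm_pow, Real.norm_of_nonneg ht.1]
    exact hc t ht
  have h2 : (fun h : ℝ => F (M.step F h 0) - P (M.step F h 0)) =O[𝓝 0] fun h => h ^ s := by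
    refine IsBigO.trans (IsBigO.of_bound B (Eventually.of_forall fun h => ?_))
      (hΦ0.norm_left.pow s)
    simpa using hFP _
  have h3 : (fun h : ℝ => P (M.step F h 0) - P (φ h)) =O[𝓝 0] fun h => h ^ s :=
    ((ContDiffAt.comp_sub_comp_isBigO hP1 hΦt hφt).trans hΔ).trans hpow
  -- After subtraction of the integrated polynomial the derivative is O(h^s), so the mean value
  -- inequality gives R = O(h^{s+1}).
  set R : ℝ → V := fun h => M.step F h 0 - φ h -
    ∑ j ∈ Finset.range s, h ^ (j + 1) • ((j : ℝ) + 1)⁻¹ • c j with hR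
  have hR' : (fun h : ℝ => F (M.step F h 0) + ρ h - P (φ h) -
      ∑ j ∈ Finset.range s, h ^ j • c j) =O[𝓝[≥] 0] fun h => h ^ s :=
    ((h1.add (h2.mono nhdsWithin_le_nhds)).add (h3.mono nhdsWithin_le_nhds)).congr_left
      fun h => by abel
  obtain ⟨A, hA, hA'⟩ := hR'.exists_pos
  obtain ⟨δ, hδ, hδ'⟩ := mem_nhdsGE_iff_exists_Icc_subset.1
    (inter_mem (inter_mem hA'.bound (mem_nhdsWithin_of_mem_nhds hφ'))
      (Icc_mem_nhdsGE (zero_lt_one' ℝ)))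
  have hR0 : R 0 = 0 := by
    have : M.step F 0 0 = (0 : V) := by simp [ExplicitRK.step]
    simp [hR, this, hφ0]
  have hRO : R =O[𝓝[>] 0] fun h => h ^ (s + 1) := by
    refine IsBigO.of_bound A ?_
    filter_upwards [Ioc_mem_nhdsGT hδ] with t ht
    have := norm_image_sub_le_of_norm_deriv_le_segment' (f := R) (a := 0) (b := t)
      (f' := fun h => F (M.step F h 0) + ρ h - P (φ h) - ∑ j ∈ Finset.range s, h ^ j • c j)
      (C := A * t ^ s) (fun x hx => ?_) (fun x hx => ?_) t ⟨ht.1.le, le_rfl⟩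
    · rw [hR0, sub_zero, sub_zero] at this
      rw [norm_pow, Real.norm_of_nonneg ht.1.le, pow_succ, ← mul_assoc]
      exact this
    · have hx' := hδ' ⟨hx.1, hx.2.trans ht.2⟩
      exact (((hρ x hx'.2).sub hx'.1.2).sub
        (HasDerivAt.fun_sum fun j _ => hasDerivAt_pow_succ_smul j (c j) x)).hasDerivWithinAt
    · have hx' : ‖_‖ ≤ A * ‖_‖ := (hδ' ⟨hx.1, hx.2.le.trans ht.2⟩).1.1
      refine hx'.trans (mul_le_mul_of_nonneg_left ?_ hA.le)
      rw [norm_pow, Real.norm_of_nonneg hx.1]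
      exact pow_le_pow_left₀ hx.1 hx.2.le s
  have hsum : (fun t : ℝ => ∑ j ∈ Finset.range (s + 1),
      t ^ j • (Nat.casesOn j 0 fun i => ((i : ℝ) + 1)⁻¹ • c i : V)) =O[𝓝[>] 0]
      fun t => t ^ (s + 1) := by
    refine ((hΔ.mono nhdsWithin_le_nhds).sub hRO).congr_left fun t => ?_
    rw [Finset.sum_range_succ']
    simp [hR]
  intro j hj
  have := eq_zero_of_sum_pow_smul_isBigO hsum (j + 1) (by omega)
  have hj' : ((j : ℝ) + 1)⁻¹ ≠ 0 := by positivity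
  exact (smul_eq_zero.1 this).resolve_left hj'

/-- Uniform local error bound: for an integrator of order `s`, the numerical solution solves the
system up to a residual of size `C t ^ s`, where `C` depends on the vector field only through a
bound for its derivatives up to order `s`. -/
theorem ExplicitRK.HasOrder.exists_residual_bound {M : ExplicitRK} {s : ℕ} (hM : M.HasOrder s)
    (hs : s ≠ 0) (B : ℝ) :
    ∃ C : ℝ, ∀ {V : Type} [NormedAddCommGroup V] [NormedSpace ℝ V] [FiniteDimensional ℝ V]
      (F : V → V), SmoothBound B s F → ‖F 0‖ ≤ B →
      ∃ ρ : ℝ → V, ∀ t ∈ Set.Icc (0 : ℝ) 1,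
        HasDerivAt (fun t => M.step F t 0) (F (M.step F t 0) + ρ t) t ∧ ‖ρ t‖ ≤ C * t ^ s := by
  obtain ⟨C, hC⟩ := M.exists_residual_taylorBound hs B
  refine ⟨C, fun F hF h0 => ?_⟩
  obtain ⟨ρ, ⟨c, hc⟩, hρ⟩ := hC F hF h0
  refine ⟨ρ, fun t ht => ⟨hρ t ht, ?_⟩⟩
  have hz := hM.residual_coeff_eq_zero hs ((norm_nonneg _).trans h0) hF hc hρ
  have := hc t ht
  rwa [Finset.sum_eq_zero fun j hj => ?_, sub_zero] at this
  rw [hz j (Finset.mem_range.1 hj), smul_zero]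

end Order

end HeavyBall

namespace HeavyBall

/-! ### Consequences of smoothness and quasi-strong convexity. -/

section Objective

variable {X : Type} [NormedAddCommGroup X] [InnerProductSpace ℝ X]

theorem HighOrderSmooth.differentiable {f : X → ℝ} {s : ℕ} {L : ℝ} (h : HighOrderSmooth f s L) :
    Differentiable ℝ f := by
  have h := h.1 0 (Nat.zero_le s)
  rw [iteratedFDeriv_zero_eq_comp] at h
  exact (LinearIsometryEquiv.comp_differentiable_iff _).1 h

variable [CompleteSpace X]

theorem HighOrderSmooth.smoothBound_gradient {f : X → ℝ} {s : ℕ} {L : ℝ}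
    (h : HighOrderSmooth f s L) : SmoothBound L s (gradient f) := by
  have h1 : SmoothBound L s (fderiv ℝ f) := by
    refine smoothBound_of_iteratedFDeriv (fun i hi => ?_) fun i h1 hi x => ?_
    · exact differentiable_iteratedFDeriv_fderiv (h.1 (i + 1) hi)
    · rw [norm_iteratedFDeriv_fderiv]
      exact h.2 (i + 1) (by omega) (by omega) x
  -- The inverse Riesz map is conjugate-linear by type; over ℝ it is recast as a linear map of norm
  -- at most 1.
  have h2 := h1.clm_comp (r := 1) (LinearMap.mkContinuous
    { toFun := (InnerProductSpace.toDual ℝ X).symm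
      map_add' := map_add _
      map_smul' := fun c v => by simp } 1
    fun v => by
      rw [one_mul]
      exact le_of_eq ((InnerProductSpace.toDual ℝ X).symm.norm_map v))
    (LinearMap.mkContinuous_norm_le _ zero_le_one _)
  rw [one_mul] at h2
  exact h2

theorem hasDerivAt_comp_gradient {f : X → ℝ} (hf : Differentiable ℝ f) {x : ℝ → X} {x' : X}
    {t : ℝ} (hx : HasDerivAt x x' t) :
    HasDerivAt (fun t => f (x t)) (inner ℝ (gradient f (x t)) x') t := by
  have := (hf (x t)).hasGradientAt.hasFDerivAt.comp_hasDerivAt t hx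
  simpa [Function.comp_def] using this

/-- A function with an `L`-Lipschitz gradient has `‖∇f(x)‖² ≤ 2 L (f(x) - min f)`. -/
theorem norm_gradient_sq_le {f : X → ℝ} (hf : Differentiable ℝ f) {L : ℝ} (hL : 0 < L)
    (hg : ∀ x y, ‖gradient f y - gradient f x‖ ≤ L * ‖y - x‖) {m : ℝ} (hm : ∀ x, m ≤ f x)
    (x : X) : ‖gradient f x‖ ^ 2 ≤ 2 * L * (f x - m) := by
  set g := gradient f x
  -- This is the descent lemma: ψ does not increase, and t = 1/L is the best gradient step.
  set ψ : ℝ → ℝ := fun t => f (x - t • g) + (t - L * t ^ 2 / 2) * ‖g‖ ^ 2 with hψ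
  have hd : ∀ t, HasDerivAt ψ (inner ℝ (gradient f (x - t • g)) (-g) + (1 - L * t) * ‖g‖ ^ 2) t := by
    intro t
    have h1 : HasDerivAt (fun t : ℝ => x - t • g) (-g) t := by
      simpa using ((hasDerivAt_id t).smul_const g).const_sub x
    refine (hasDerivAt_comp_gradient hf h1).add (HasDerivAt.mul_const ?_ _)
    have := (hasDerivAt_id t).sub (((hasDerivAt_pow 2 t).const_mul L).div_const 2)
    refine this.congr_deriv ?_
    simp
    ring
  have hanti : AntitoneOn ψ (Set.Ici 0) := by
    refine antitoneOn_of_deriv_nonpos (convex_Ici 0)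
      (fun t _ => (hd t).continuousAt.continuousWithinAt)
      (fun t _ => (hd t).differentiableAt.differentiableWithinAt) fun t ht => ?_
    rw [interior_Ici] at ht
    have ht : 0 < t := ht
    rw [(hd t).deriv]
    have h1 := hg (x - t • g) x
    rw [sub_sub_cancel, norm_smul, Real.norm_of_nonneg ht.le] at h1
    have h2 := real_inner_le_norm (g - gradient f (x - t • g)) g
    rw [inner_sub_left, real_inner_self_eq_norm_sq] at h2
    have h3 := mul_le_mul_of_nonneg_right h1 (norm_nonneg g)
    rw [inner_neg_right]
    nlinarith
  have h := hanti (Set.mem_Ici.2 le_rfl) (Set.mem_Ici.2 (inv_pos.2 hL).le) (inv_pos.2 hL).le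
  simp only [hψ, zero_smul, sub_zero] at h
  have h4 := hm (x - L⁻¹ • g)
  have h5 : (L⁻¹ - L * L⁻¹ ^ 2 / 2) * ‖g‖ ^ 2 = ‖g‖ ^ 2 / (2 * L) := by
    field_simp
    ring
  rw [h5] at h
  have h6 : ‖g‖ ^ 2 / (2 * L) ≤ f x - m := by
    norm_num at h
    linarith
  rw [div_le_iff₀ (by positivity)] at h6
  linarith

theorem gradient_eq_zero_of_forall_le {f : X → ℝ} {xs : X} (h : ∀ x, f xs ≤ f x) :
    gradient f xs = 0 := by
  have : fderiv ℝ f xs = 0 := IsLocalMin.fderiv_eq_zero (Filter.Eventually.of_forall h)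
  rw [gradient, this, map_zero]

theorem QuasiStronglyConvex.le_inner {f : X → ℝ} {μ : ℝ} {xs : X}
    (h : QuasiStronglyConvex f μ xs) (x : X) :
    f x - f xs + μ / 2 * ‖x - xs‖ ^ 2 ≤ inner ℝ (gradient f x) (x - xs) := by
  have := h.2 x
  rw [← neg_sub x xs, inner_neg_right] at this
  linarith

/-- The two constants satisfy `μ ≤ L`, and the gradient is controlled by the function value. -/
theorem QuasiStronglyConvex.le_and_norm_gradient_sq_le [Nontrivial X] {f : X → ℝ} {μ L : ℝ}
    {xs : X} (h : QuasiStronglyConvex f μ xs) (hμ : 0 < μ) (hf : Differentiable ℝ f)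
    (hg : ∀ x y, ‖gradient f y - gradient f x‖ ≤ L * ‖y - x‖) :
    μ ≤ L ∧ ∀ x, ‖gradient f x‖ ^ 2 ≤ 2 * L * (f x - f xs) := by
  obtain ⟨x, hx⟩ := exists_ne xs
  have hr : 0 < ‖x - xs‖ := norm_pos_iff.2 (sub_ne_zero.2 hx)
  have h1 := (h.le_inner x).trans (real_inner_le_norm _ _)
  have h2 := hg xs x
  rw [gradient_eq_zero_of_forall_le h.1, sub_zero] at h2
  have hΔ := sub_nonneg.2 (h.1 x)
  have hL : 0 < L := by
    by_contra hL
    nlinarith [mul_le_mul_of_nonneg_right h2 hr.le, mul_pos hμ (pow_pos hr 2)]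
  have hgrad := norm_gradient_sq_le hf hL hg h.1
  refine ⟨?_, hgrad⟩
  have h3 := hgrad x
  set Δ := f x - f xs
  set g := ‖gradient f x‖
  set r := ‖x - xs‖
  have hg0 : 0 ≤ g := norm_nonneg _
  have h4 : 0 < Δ := by
    rcases hΔ.lt_or_eq with h | h
    · exact h
    · rw [← h] at h1 h3
      have : g = 0 := by nlinarith
      rw [this] at h1
      nlinarith [mul_pos hμ (pow_pos hr 2)]
  have h5 : (Δ + μ / 2 * r ^ 2) ^ 2 ≤ (g * r) ^ 2 :=
    pow_le_pow_left₀ (by positivity) h1 2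
  -- Since (Δ + μ r²/2)² ≥ 2 μ Δ r² by the arithmetic-geometric mean inequality, comparison with 2 L
  -- Δ r² yields μ ≤ L.
  have h6 : g ^ 2 * r ^ 2 ≤ 2 * L * Δ * r ^ 2 := mul_le_mul_of_nonneg_right h3 (by positivity)
  have h7 : μ * (Δ * r ^ 2) ≤ L * (Δ * r ^ 2) := by
    nlinarith [sq_nonneg (Δ - μ / 2 * r ^ 2)]
  exact le_of_mul_le_mul_right h7 (by positivity)

end Objective

/-! ### Decay of the Lyapunov function along perturbed solutions. -/

section Lyapunov

variable {X : Type} [NormedAddCommGroup X] [InnerProductSpace ℝ X]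

theorem lyapunov_bounds {f : X → ℝ} {μ L : ℝ} {xs : X} (hμ : 0 < μ) (hL : μ ≤ L)
    (hmin : ∀ x, f xs ≤ f x) (y : X × X) :
    2 * (f y.2 - f xs) / μ ≤ lyapunov f μ L xs y ∧
      √(L / μ) * ‖y.1‖ ≤ 2 * √(lyapunov f μ L xs y) ∧
      ‖y.2 + √(L / μ) • y.1 - xs‖ ≤ 2 * √(lyapunov f μ L xs y) ∧
      0 ≤ lyapunov f μ L xs y := by
  have hQ : 0 ≤ L / μ := div_nonneg (hμ.le.trans hL) hμ.le
  have h1 : 0 ≤ 2 * (f y.2 - f xs) / μ :=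
    div_nonneg (mul_nonneg zero_le_two (sub_nonneg.2 (hmin _))) hμ.le
  have h2 : 0 ≤ (L / μ) / 2 * ‖y.1‖ ^ 2 := by positivity
  have h3 : 0 ≤ 1 / 2 * ‖y.2 + √(L / μ) • y.1 - xs‖ ^ 2 := by positivity
  have hu : 0 ≤ lyapunov f μ L xs y := by
    rw [lyapunov]
    linarith
  have hsq := Real.sq_sqrt hu
  refine ⟨by rw [lyapunov]; linarith, ?_, ?_, hu⟩
  · refine abs_le_of_sq_le_sq' ?_ (by positivity) |>.2
    rw [mul_pow, mul_pow, hsq, Real.sq_sqrt hQ, lyapunov]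
    linarith
  · refine abs_le_of_sq_le_sq' ?_ (by positivity) |>.2
    rw [mul_pow, hsq, lyapunov]
    linarith

theorem norm_gradient_le_lyapunov [CompleteSpace X] {f : X → ℝ} {μ L : ℝ} {xs : X} (hμ : 0 < μ)
    (hL : μ ≤ L) (hmin : ∀ x, f xs ≤ f x)
    (hg : ∀ x, ‖gradient f x‖ ^ 2 ≤ 2 * L * (f x - f xs)) (y : X × X) :
    ‖gradient f y.2‖ ≤ μ * √(L / μ) * √(lyapunov f μ L xs y) := by
  obtain ⟨h1, -, -, hu⟩ := lyapunov_bounds hμ hL hmin y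
  have hL0 := hμ.trans_le hL
  refine abs_le_of_sq_le_sq' ?_ (by positivity) |>.2
  rw [mul_pow, mul_pow, Real.sq_sqrt hu, Real.sq_sqrt (by positivity)]
  refine (hg y.2).trans ?_
  rw [div_le_iff₀ hμ] at h1
  have : μ ^ 2 * (L / μ) = L * μ := by field_simp
  rw [this]
  nlinarith

/-- Along a curve that solves the heavy-ball system up to a residual `e`, the Lyapunov function
decays up to an error which is linear in `e`. -/
theorem exists_hasDerivAt_lyapunov [CompleteSpace X] {f : X → ℝ} {μ L : ℝ} {xs : X} (hμ : 0 < μ)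
    (hL : μ ≤ L) (hf : Differentiable ℝ f) (hq : QuasiStronglyConvex f μ xs)
    (hg : ∀ x, ‖gradient f x‖ ^ 2 ≤ 2 * L * (f x - f xs)) {Y : ℝ → X × X} {e : X × X} {t η : ℝ}
    (hY : HasDerivAt Y (field μ L (gradient f) (Y t) + e) t) (he : ‖e‖ ≤ η) :
    ∃ D, HasDerivAt (fun t => lyapunov f μ L xs (Y t)) D t ∧
      D ≤ -(lyapunov f μ L xs (Y t)) / 2
        + 8 * √(L / μ) * √(lyapunov f μ L xs (Y t)) * η := by
  obtain ⟨hΔ, hw, hv, hu⟩ := lyapunov_bounds hμ hL hq.1 (Y t)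
  have hgr := norm_gradient_le_lyapunov hμ hL hq.1 hg (Y t)
  have hin := hq.le_inner (Y t).2
  have hQ : 1 ≤ L / μ := (one_le_div hμ).2 hL
  have hQq : √(L / μ) ^ 2 = L / μ := Real.sq_sqrt (by linarith)
  have hq1 : 1 ≤ √(L / μ) := Real.one_le_sqrt.2 hQ
  have hex : ‖e.2‖ ≤ η := (norm_snd_le e).trans he
  have hew : ‖e.1‖ ≤ η := (norm_fst_le e).trans he
  have hη : 0 ≤ η := (norm_nonneg _).trans he
  have hw' := (ContinuousLinearMap.fst ℝ X X).hasFDerivAt.comp_hasDerivAt t hY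
  have hx' := (ContinuousLinearMap.snd ℝ X X).hasFDerivAt.comp_hasDerivAt t hY
  have hD := (((((hasDerivAt_comp_gradient hf hx').sub_const (f xs)).const_mul 2).div_const μ).add
    (hw'.norm_sq.const_mul (L / μ / 2))).add
    (((hx'.add (hw'.const_smul √(L / μ))).sub_const xs).norm_sq.const_mul (1 / 2))
  refine ⟨_, hD, ?_⟩
  simp only [lyapunov] at *
  simp only [field, ContinuousLinearMap.coe_fst', ContinuousLinearMap.coe_snd', Function.comp_apply,
    Prod.fst_add, Prod.snd_add, Pi.add_apply, Pi.smul_apply] at *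
  set q := √(L / μ)
  set Q := L / μ
  set w := (Y t).1
  set x := (Y t).2
  set g := gradient f x
  set a := √(2 * (f x - f xs) / μ + Q / 2 * ‖w‖ ^ 2 + 1 / 2 * ‖x + q • w - xs‖ ^ 2)
  have hr : x + q • w - xs = (x - xs) + q • w := by abel
  have ha : 0 ≤ a := Real.sqrt_nonneg _
  -- The residual enters through four inner products; each contributes at most 2 q a η, hence the
  -- constant 8.
  have b1 : inner ℝ g e.2 ≤ μ * q * a * η :=
    (real_inner_le_norm _ _).trans (mul_le_mul hgr hex (norm_nonneg _) (by positivity))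
  have b2 : q * inner ℝ w e.1 ≤ 2 * a * η := by
    refine (mul_le_mul_of_nonneg_left (real_inner_le_norm _ _) (by positivity)).trans ?_
    rw [← mul_assoc]
    exact mul_le_mul hw hew (norm_nonneg _) (by positivity)
  have b3 : inner ℝ (x + q • w - xs) e.2 ≤ 2 * a * η :=
    (real_inner_le_norm _ _).trans (mul_le_mul hv hex (norm_nonneg _) (by positivity))
  have b4 : inner ℝ (x + q • w - xs) e.1 ≤ 2 * a * η :=
    (real_inner_le_norm _ _).trans (mul_le_mul hv hew (norm_nonneg _) (by positivity))
  have c1 : 2 / μ * inner ℝ g e.2 ≤ 2 * (q * a * η) := by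
    rw [div_mul_eq_mul_div, div_le_iff₀ hμ]
    linarith
  have c2 : q * (q * inner ℝ w e.1) ≤ q * (2 * a * η) :=
    mul_le_mul_of_nonneg_left b2 (by positivity)
  have c4 : q * inner ℝ (x + q • w - xs) e.1 ≤ q * (2 * a * η) :=
    mul_le_mul_of_nonneg_left b4 (by positivity)
  have c3 : 2 * a * η ≤ q * (2 * a * η) := le_mul_of_one_le_left (by positivity) hq1
  rw [hr] at b3 b4 c4 ⊢
  have hnorm := norm_add_sq_real (x - xs) (q • w)
  have hqw : ‖q • w‖ ^ 2 = q ^ 2 * ‖w‖ ^ 2 := by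
    rw [norm_smul, Real.norm_of_nonneg (by positivity), mul_pow]
  rw [hqw, inner_smul_right] at hnorm
  have hpos := sq_nonneg ‖x - xs + q • w‖
  have hin' : (f x - f xs) / μ + 1 / 2 * ‖x - xs‖ ^ 2 ≤ 1 / μ * inner ℝ g (x - xs) := by
    rw [one_div_mul_eq_div (a := μ), le_div_iff₀ hμ]
    refine le_trans (le_of_eq ?_) hin
    field_simp
  have hq0 : q ≠ 0 := by positivity
  -- The terms in ⟨g, w⟩ cancel. With r = x - xs, quasi-strong convexity bounds -⟨g, r⟩/μ, and
  -- completing the square in r + q w leaves only nonpositive terms.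
  have key : ∀ r : X, 2 * inner ℝ g (q • w + e.2) / μ
      + q ^ 2 / 2 * (2 * inner ℝ w (-((2 : ℝ) • w) - (1 / (μ * q)) • g + e.1))
      + 1 / 2 * (2 * inner ℝ (r + q • w)
        (q • w + e.2 + q • (-((2 : ℝ) • w) - (1 / (μ * q)) • g + e.1)))
      = -3 * (q ^ 2 * ‖w‖ ^ 2) - q * inner ℝ r w - 1 / μ * inner ℝ g r
        + (2 / μ * inner ℝ g e.2 + q * (q * inner ℝ w e.1)
          + inner ℝ (r + q • w) e.2 + q * inner ℝ (r + q • w) e.1) := by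
    intro r
    simp only [inner_add_right, inner_add_left, inner_sub_right, inner_neg_right,
      real_inner_smul_left, real_inner_smul_right, real_inner_self_eq_norm_sq, hqw,
      real_inner_comm g w, real_inner_comm g r]
    field_simp
    ring
  have hlast := key (x - xs)
  have hdiv : 2 * (f x - f xs) / μ = 2 * ((f x - f xs) / μ) := mul_div_assoc _ _ _
  rw [← hQq]
  have hQW : 0 ≤ q ^ 2 * ‖w‖ ^ 2 := by positivity
  refine (le_of_eq hlast).trans ?_
  rw [hdiv]
  linarith

end Lyapunov

end HeavyBall

namespace HeavyBall

/-! ### Rescaling and contraction in one step. -/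

section Descent

variable {X : Type} [NormedAddCommGroup X] [InnerProductSpace ℝ X]

/-- The linear part `(w, x) ↦ (-2 w, q x)` of the heavy-ball field. -/
def linearPart (X : Type) [NormedAddCommGroup X] [InnerProductSpace ℝ X] (q : ℝ) :
    X × X →L[ℝ] X × X :=
  ((-2 : ℝ) • ContinuousLinearMap.fst ℝ X X).prod (q • ContinuousLinearMap.fst ℝ X X)

theorem norm_linearPart_le {q r : ℝ} (hq : 0 ≤ q) (hr : 1 ≤ r) (hqr : q ≤ r) :
    ‖linearPart X q‖ ≤ 2 * r := by
  refine ContinuousLinearMap.opNorm_le_bound _ (by positivity) fun y => ?_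
  have hy := norm_fst_le y
  have h : linearPart X q y = ((-2 : ℝ) • y.1, q • y.1) := rfl
  rw [h, norm_prod_le_iff, norm_smul, norm_smul, Real.norm_of_nonneg hq]
  constructor
  · norm_num
    nlinarith [norm_nonneg y.1, norm_nonneg y]
  · nlinarith [norm_nonneg y.1, norm_nonneg y]

variable [CompleteSpace X]

/-- After rescaling with `√E` and `√m`, where `m ≥ max {E, Q}`, the heavy-ball field and its
derivatives up to order `s` are bounded by an absolute constant. -/
theorem smoothBound_rescaled_field {f : X → ℝ} {s : ℕ} {μ L m u : ℝ} (hμ : 0 < μ) (hL : μ ≤ L)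
    (hf : SmoothBound L s (gradient f)) (hu : 0 < u) (hum : u ≤ m) (hQm : L / μ ≤ m) (y : X × X) :
    SmoothBound 4 s fun z => (√u)⁻¹ • field μ L (gradient f) (y + (√u / √m) • z) := by
  have hQ : 1 ≤ L / μ := (one_le_div hμ).2 hL
  have hL0 : 0 < L := hμ.trans_le hL
  have hq1 : 1 ≤ √(L / μ) := Real.one_le_sqrt.2 hQ
  have hqm : √(L / μ) ≤ √m := Real.sqrt_le_sqrt hQm
  have huq : √u ≤ √m := Real.sqrt_le_sqrt hum
  have hu' : 0 < √u := Real.sqrt_pos.2 hu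
  have hQq : √(L / μ) * √(L / μ) = L / μ := Real.mul_self_sqrt (by linarith)
  set q := √(L / μ)
  set r := √m
  set v := √u
  have hr : 0 < r := by linarith
  have hδ : v / r ≤ 1 := (div_le_one hr).2 huq
  have h1 : SmoothBound 2 s fun z : X × X =>
      v⁻¹ • linearPart X q y + ((v⁻¹ * (v / r)) • linearPart X q) z := by
    refine smoothBound_affine s _ _ ?_
    rw [norm_smul, Real.norm_of_nonneg (by positivity)]
    refine (mul_le_mul_of_nonneg_left (norm_linearPart_le (by linarith) (hq1.trans hqm) hqm)
      (by positivity)).trans (le_of_eq ?_)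
    field_simp
  have hs : ‖(v / r) • ContinuousLinearMap.snd ℝ X X‖ ≤ v / r := by
    refine ContinuousLinearMap.opNorm_le_bound _ (by positivity) fun z => ?_
    rw [smul_apply, norm_smul, Real.norm_of_nonneg (by positivity)]
    exact mul_le_mul_of_nonneg_left (norm_snd_le z) (by positivity)
  have hi : ‖(-(v⁻¹ * (1 / (μ * q)))) • ContinuousLinearMap.inl ℝ X X‖ ≤ v⁻¹ * (1 / (μ * q)) := by
    refine ContinuousLinearMap.opNorm_le_bound _ (by positivity) fun z => ?_
    rw [smul_apply, norm_smul, norm_neg, Real.norm_of_nonneg (by positivity)]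
    simp
  have h2 := (hf.comp_affine hL0.le hδ ((v / r) • ContinuousLinearMap.snd ℝ X X) hs y.2).clm_comp
    ((-(v⁻¹ * (1 / (μ * q)))) • ContinuousLinearMap.inl ℝ X X) hi
  -- One factor v/r cancels v⁻¹, and L/(μ q) = q leaves q/r ≤ 1. The linear part adds at most 2.
  have h3 : v⁻¹ * (1 / (μ * q)) * (v / r * L) ≤ 1 := by
    have : v⁻¹ * (1 / (μ * q)) * (v / r * L) = q / r := by
      have hLq : L = μ * (q * q) := by rw [hQq]; field_simp
      rw [hLq]
      field_simp
    rw [this]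
    exact (div_le_one hr).2 hqm
  have h4 := (h1.add h2).mono (show _ ≤ (4 : ℝ) by linarith)
  convert h4 using 2 with z
  ext
  · simp [field, linearPart]
    module
  · simp [field, linearPart]
    module

/-- This bounds the rescaled field at the origin and shows that 𝓔 = 0 only at equilibria. -/
theorem norm_field_le {f : X → ℝ} {μ L : ℝ} {xs : X} (hμ : 0 < μ) (hL : μ ≤ L)
    (hmin : ∀ x, f xs ≤ f x) (hg : ∀ x, ‖gradient f x‖ ^ 2 ≤ 2 * L * (f x - f xs)) (y : X × X) :
    ‖field μ L (gradient f) y‖ ≤ 5 * √(lyapunov f μ L xs y) := by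
  obtain ⟨-, hw, -, -⟩ := lyapunov_bounds hμ hL hmin y
  have hgr := norm_gradient_le_lyapunov hμ hL hmin hg y
  have hq1 : 1 ≤ √(L / μ) := Real.one_le_sqrt.2 ((one_le_div hμ).2 hL)
  have ha := Real.sqrt_nonneg (lyapunov f μ L xs y)
  set q := √(L / μ)
  set a := √(lyapunov f μ L xs y)
  rw [field, norm_prod_le_iff]
  constructor
  · refine (norm_sub_le _ _).trans ?_
    rw [norm_neg, norm_smul, norm_smul, Real.norm_of_nonneg (by positivity),
      Real.norm_of_nonneg (by positivity : (0 : ℝ) ≤ 1 / (μ * q)), one_div_mul_eq_div]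
    have h1 : ‖gradient f y.2‖ / (μ * q) ≤ a := by
      rw [div_le_iff₀ (by positivity)]
      linarith
    have h2 : ‖y.1‖ ≤ q * ‖y.1‖ := le_mul_of_one_le_left (norm_nonneg _) hq1
    linarith
  · rw [norm_smul, Real.norm_of_nonneg (by positivity)]
    linarith

/-- One step of the integrator decreases the Lyapunov function. -/
theorem lyapunov_step_le [FiniteDimensional ℝ X] {M : ExplicitRK} {s : ℕ} {C : ℝ}
    (hC : ∀ F : X × X → X × X, SmoothBound 5 s F → ‖F 0‖ ≤ 5 →
      ∃ ρ : ℝ → X × X, ∀ t ∈ Set.Icc (0 : ℝ) 1,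
        HasDerivAt (fun t => M.step F t 0) (F (M.step F t 0) + ρ t) t ∧ ‖ρ t‖ ≤ C * t ^ s)
    (hC0 : 0 ≤ C) {f : X → ℝ} {μ L : ℝ} {xs : X} (hμ : 0 < μ) (hL : μ ≤ L)
    (hf : Differentiable ℝ f) (hq : QuasiStronglyConvex f μ xs)
    (hsm : SmoothBound L s (gradient f))
    (hg : ∀ x, ‖gradient f x‖ ^ 2 ≤ 2 * L * (f x - f xs)) {m h : ℝ} {y : X × X}
    (hy : lyapunov f μ L xs y ≤ m) (hQm : L / μ ≤ m) (hh : 0 < h) (hh4 : h ≤ 1 / 4)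
    (hhm : √m * h ≤ 1) (hsmall : 64 * (C * (√(L / μ) * (√m * h) ^ s)) ≤ 1) :
    lyapunov f μ L xs (M.step (field μ L (gradient f)) h y)
      ≤ (1 - h / 4) * lyapunov f μ L xs y := by
  obtain ⟨-, -, -, hu⟩ := lyapunov_bounds hμ hL hq.1 y
  have hfield := norm_field_le hμ hL hq.1 hg y
  have hm : 1 ≤ √m := Real.one_le_sqrt.2 (((one_le_div hμ).2 hL).trans hQm)
  -- If 𝓔(y) = 0, rescaling by √𝓔(y) is impossible, but y is an equilibrium, which the integrator
  -- fixes.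
  rcases hu.eq_or_lt with hu | hu
  · rw [← hu, Real.sqrt_zero, mul_zero, norm_le_zero_iff] at hfield
    rw [M.step_of_eq_zero hfield, ← hu, mul_zero]
  have hv : 0 < √(lyapunov f μ L xs y) := Real.sqrt_pos.2 hu
  have hsb := (smoothBound_rescaled_field hμ hL hsm hu hy hQm y).mono (by norm_num : (4 : ℝ) ≤ 5)
  have hvv : √(lyapunov f μ L xs y) * √(lyapunov f μ L xs y) = lyapunov f μ L xs y :=
    Real.mul_self_sqrt hu.le
  set u₀ := lyapunov f μ L xs y
  set v := √u₀
  set r := √m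
  have hr : 0 < r := by linarith
  set G : X × X → X × X := fun z => v⁻¹ • field μ L (gradient f) (y + (v / r) • z)
  have hG0 : ‖G 0‖ ≤ 5 := by
    simp only [G, smul_zero, add_zero]
    rw [norm_smul, norm_inv, Real.norm_of_nonneg hv.le, inv_mul_le_iff₀ hv]
    linarith
  obtain ⟨ρ, hρ⟩ := hC G hsb hG0
  have hGF : ∀ z, r⁻¹ • field μ L (gradient f) (y + (v / r) • z) = (v / r) • G z := fun z => by
    simp only [G, smul_smul]
    congr 1
    field_simp
  set Y : ℝ → X × X := fun t => M.step (field μ L (gradient f)) t y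
  have hYeq : ∀ t, Y t = y + (v / r) • M.step G (r * t) 0 := fun t => by
    have := M.step_affine hGF (r * t)
    rwa [inv_mul_cancel_left₀ hr.ne'] at this
  have hmem : ∀ t ∈ Set.Icc 0 h, r * t ∈ Set.Icc (0 : ℝ) 1 := fun t ht =>
    ⟨by have := ht.1; positivity, (mul_le_mul_of_nonneg_left ht.2 hr.le).trans hhm⟩
  have hY : ∀ t ∈ Set.Icc 0 h,
      HasDerivAt Y (field μ L (gradient f) (Y t) + v • ρ (r * t)) t := fun t ht => by
    have h1 := (hρ (r * t) (hmem t ht)).1.scomp t ((hasDerivAt_id t).const_mul r)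
    have h2 := (h1.const_smul (v / r)).const_add y
    have h3 : Y = fun t => y + (v / r) • M.step G (r * t) 0 := funext hYeq
    have h4 : field μ L (gradient f) (Y t) = v • G (M.step G (r * t) 0) := by
      rw [hYeq t]
      simp only [G, smul_smul]
      rw [mul_inv_cancel₀ hv.ne', one_smul]
    rw [h4, h3]
    refine h2.congr_deriv ?_
    rw [smul_smul, ← smul_add]
    congr 1
    field_simp
  have he : ∀ t ∈ Set.Icc 0 h, ‖v • ρ (r * t)‖ ≤ v * (C * (r * h) ^ s) := fun t ht => by
    rw [norm_smul, Real.norm_of_nonneg hv.le]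
    refine mul_le_mul_of_nonneg_left ((hρ (r * t) (hmem t ht)).2.trans ?_) hv.le
    exact mul_le_mul_of_nonneg_left (pow_le_pow_left₀ (hmem t ht).1
      (mul_le_mul_of_nonneg_left ht.2 hr.le) s) hC0
  choose! D hD hDle using fun t ht => exists_hasDerivAt_lyapunov hμ hL hf hq hg (hY t ht) (he t ht)
  have hY0 : Y 0 = y := by simp [Y, ExplicitRK.step]
  have hB : ∀ x, HasDerivAt (fun t : ℝ => (1 - t / 4) * u₀) (-(1 / 4) * u₀) x := fun x =>
    (((hasDerivAt_id x).div_const 4).const_sub 1).mul_const u₀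
  -- The barrier is (1 - t/4) u₀; the strict derivative inequality is needed only at contact times,
  -- where u = (1 - t/4) u₀ ≥ 15/16 u₀.
  refine image_le_of_deriv_right_lt_deriv_boundary
    (fun t ht => (hD t ht).continuousAt.continuousWithinAt)
    (fun t ht => (hD t (Set.Ico_subset_Icc_self ht)).hasDerivWithinAt) (a := 0) (b := h)
    (le_of_eq ?_) hB (fun t ht hft => ?_) ⟨hh.le, le_rfl⟩
  · rw [hY0]
    ring
  · refine (hDle t (Set.Ico_subset_Icc_self ht)).trans_lt ?_
    obtain ⟨-, -, -, hut⟩ := lyapunov_bounds hμ hL hq.1 (Y t)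
    have haa := Real.mul_self_sqrt hut
    have ha0 := Real.sqrt_nonneg (lyapunov f μ L xs (Y t))
    set u := lyapunov f μ L xs (Y t)
    set a := √u
    have h1 : 8 * √(L / μ) * a * (v * (C * (r * h) ^ s)) ≤ a * v / 8 := by
      have := mul_le_mul_of_nonneg_right hsmall (mul_nonneg ha0 hv.le)
      linarith
    -- The derivative is thus at most -u/2 + (u + u₀)/16, which at contact lies strictly below
    -- -u₀/4.
    have h2 : 2 * (a * v) ≤ u + u₀ := by nlinarith [sq_nonneg (a - v)]
    have h3 : t * u₀ ≤ 1 / 4 * u₀ := mul_le_mul_of_nonneg_right (ht.2.le.trans hh4) hu.le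
    linarith

end Descent

/-! ### Iteration, step size and number of steps. -/

section Rate

/-- Contraction keeps the iterates in the sublevel set {E ≤ m}, so one step size serves all steps.
-/
theorem ExplicitRK.lyapunov_iter_le {X : Type} [NormedAddCommGroup X] [InnerProductSpace ℝ X]
    {M : ExplicitRK} {F : X × X → X × X} {E : X × X → ℝ} {m h : ℝ}
    (hE : ∀ y, 0 ≤ E y) (hh : 0 < h) (hh4 : h ≤ 1 / 4)
    (hstep : ∀ y, E y ≤ m → E (M.step F h y) ≤ (1 - h / 4) * E y) {y₀ : X × X} (h0 : E y₀ ≤ m)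
    (N : ℕ) : E (M.iter F h y₀ N) ≤ (1 - h / 4) ^ N * E y₀ := by
  induction N with
  | zero => simp [ExplicitRK.iter]
  | succ N ih =>
    have h1 : (1 - h / 4) ^ N ≤ 1 := pow_le_one₀ (by linarith) (by linarith)
    have h2 := hstep _ (ih.trans ((mul_le_of_le_one_left (hE y₀) h1).trans h0))
    refine h2.trans ?_
    rw [pow_succ', mul_assoc]
    exact mul_le_mul_of_nonneg_left ih (by linarith)

/-- Consequences of the step size restriction, with `κ = 2 c ^ (1 / (s + 1))`. -/
theorem step_size_bounds {s : ℕ} (hs : s ≠ 0) {m h κ : ℝ} (hm : 1 ≤ m) (hκ : 4 ≤ κ) (hh : 0 < h)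
    (hle : h ≤ m ^ (-gam s) / κ) :
    h ≤ 1 / 4 ∧ √m * h ≤ 1 ∧ √m * (√m * h) ^ s ≤ κ⁻¹ := by
  have hm0 : 0 < m := by linarith
  have hs1 : (1 : ℝ) ≤ s := by exact_mod_cast Nat.one_le_iff_ne_zero.2 hs
  have hγ : (1 / 2 : ℝ) ≤ gam s := by
    rw [gam, le_div_iff₀ (by positivity)]
    linarith
  -- Since 1/2 - γ = -1/(s + 1), this exponent of m is (1 - s)/(2 (s + 1)), which is zero for s = 1.
  have hγs : 1 / 2 + (1 / 2 - gam s) * s ≤ 0 := by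
    have : 1 / 2 + (1 / 2 - gam s) * s = (1 - s) / (2 * ((s : ℝ) + 1)) := by
      rw [gam]
      field_simp
      ring
    rw [this]
    exact div_nonpos_of_nonpos_of_nonneg (by linarith) (by positivity)
  have h1 : √m * h ≤ m ^ (1 / 2 - gam s) * κ⁻¹ := by
    rw [Real.sqrt_eq_rpow, sub_eq_add_neg, Real.rpow_add hm0, mul_assoc]
    exact mul_le_mul_of_nonneg_left hle (by positivity)
  have hκ4 : κ⁻¹ ≤ 1 / 4 := by
    rw [one_div]
    exact inv_anti₀ (by norm_num) hκ
  have hκ0 : 0 ≤ κ⁻¹ := by positivity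
  have h2 : m ^ (1 / 2 - gam s) ≤ 1 := Real.rpow_le_one_of_one_le_of_nonpos hm (by linarith)
  have h3 : √m * h ≤ κ⁻¹ := h1.trans (mul_le_of_le_one_left hκ0 h2)
  have h4 : h ≤ √m * h := le_mul_of_one_le_left hh.le (Real.one_le_sqrt.2 hm)
  refine ⟨by linarith, by linarith, ?_⟩
  calc √m * (√m * h) ^ s ≤ √m * (m ^ (1 / 2 - gam s) * κ⁻¹) ^ s :=
        mul_le_mul_of_nonneg_left (pow_le_pow_left₀ (by positivity) h1 s) (Real.sqrt_nonneg m)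
    _ = m ^ (1 / 2 + (1 / 2 - gam s) * s) * κ⁻¹ ^ s := by
        rw [mul_pow, Real.rpow_add hm0, Real.rpow_mul hm0.le, Real.rpow_natCast,
          ← Real.sqrt_eq_rpow, mul_assoc]
    _ ≤ 1 * κ⁻¹ := by
        refine mul_le_mul (Real.rpow_le_one_of_one_le_of_nonpos hm hγs) ?_ (by positivity)
          zero_le_one
        exact pow_le_of_le_one hκ0 (by linarith) hs
    _ = κ⁻¹ := one_mul _

/-- The number of steps with contraction factor `1 - h / 4` that brings `a` below `ε`. -/
theorem exists_steps_le {h a ε : ℝ} (hh : 0 < h) (hh4 : h ≤ 1 / 4) (hε : 0 < ε) (ha : 0 ≤ a) :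
    ∃ N : ℕ, (N : ℝ) ≤ 6 / h * max (Real.log (a / ε)) 0 ∧
      ∀ n ≥ N, (1 - h / 4) ^ n * a ≤ 2 * ε := by
  have h0 : 0 ≤ 1 - h / 4 := by linarith
  -- The target 2ε leaves room for rounding: either no step is needed, or log(a/ε) > 1/2, and the 1
  -- lost in the ceiling is at most (2/h) log(a/ε). Hence 6 = 4 + 2.
  rcases le_or_gt a (2 * ε) with hle | hlt
  · refine ⟨0, by simpa using by positivity, fun n _ => ?_⟩
    exact (mul_le_of_le_one_left ha (pow_le_one₀ h0 (by linarith))).trans hle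
  · have ha0 : 0 < a := by linarith
    have hl : 1 / 2 < Real.log (a / ε) := by
      have h1 : Real.log 2 ≤ Real.log (a / ε) :=
        Real.log_le_log two_pos ((le_div_iff₀ hε).2 hlt.le)
      linarith [Real.log_two_gt_d9]
    set l := Real.log (a / ε)
    refine ⟨⌈4 / h * l⌉₊, ?_, fun n hn => ?_⟩
    · rw [max_eq_left (by linarith)]
      refine (Nat.ceil_lt_add_one (by positivity)).le.trans ?_
      have h1 : 1 ≤ 2 / h * l := by
        rw [div_mul_eq_mul_div, le_div_iff₀ hh]
        linarith
      have h2 : 6 / h * l = 4 / h * l + 2 / h * l := by ring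
      linarith
    · have hn' : 4 / h * l ≤ n := (Nat.le_ceil _).trans (by exact_mod_cast hn)
      have h1 : (1 - h / 4) ^ n ≤ Real.exp (-l) := by
        refine (pow_le_pow_left₀ h0 (Real.one_sub_le_exp_neg (h / 4)) n).trans ?_
        rw [← Real.exp_nat_mul]
        refine Real.exp_le_exp.2 ?_
        rw [div_mul_eq_mul_div, div_le_iff₀ hh] at hn'
        linarith
      have h2 : Real.exp (-l) * a = ε := by
        rw [Real.exp_neg, Real.exp_log (by positivity)]
        field_simp
      have h3 := mul_le_mul_of_nonneg_right h1 ha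
      linarith

end Rate

end HeavyBall

/-! ### Choice of the constants and conclusion. -/

open HeavyBall in
theorem mainTheorem1 (s : ℕ) (hs : 1 ≤ s) (M : HeavyBall.ExplicitRK) (hM : M.HasOrder s) :
    ∃ c > (0 : ℝ), ∃ C > (0 : ℝ),
      ∀ (d : ℕ) (f : EuclideanSpace ℝ (Fin d) → ℝ) (μ L : ℝ) (xs : EuclideanSpace ℝ (Fin d))
        (y₀ : EuclideanSpace ℝ (Fin d) × EuclideanSpace ℝ (Fin d)),
        0 < μ → HeavyBall.QuasiStronglyConvex f μ xs → HeavyBall.HighOrderSmooth f s L →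
        (∀ h : ℝ, 0 < h →
          h ≤ HeavyBall.maxStep s c (HeavyBall.lyapunov f μ L xs y₀) (L / μ) →
          ∀ N : ℕ,
            HeavyBall.lyapunov f μ L xs (M.iter (HeavyBall.field μ L (gradient f)) h y₀ N)
              ≤ (1 - h / 4) ^ N * HeavyBall.lyapunov f μ L xs y₀) ∧
        (∀ ε : ℝ, 0 < ε →
          ∀ h : ℝ, h = HeavyBall.maxStep s c (HeavyBall.lyapunov f μ L xs y₀) (L / μ) →
          ∃ N : ℕ,
            ((HeavyBall.algorithm M μ L h y₀ N).queries (gradient f) : ℝ)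
              ≤ C * (M.stages *
                  max (HeavyBall.lyapunov f μ L xs y₀) (L / μ) ^ HeavyBall.gam s *
                  max (Real.log (μ * HeavyBall.lyapunov f μ L xs y₀ / ε)) 0) ∧
            ∀ n ≥ N,
              f ((HeavyBall.algorithm M μ L h y₀ n).eval (gradient f)).2 - f xs ≤ ε) := by
  have hs0 : s ≠ 0 := by omega
  obtain ⟨A, hA⟩ := hM.exists_residual_bound hs0 5
  -- The 4 ensures h ≤ 1/4, and 64 A lets κ/64 serve as a nonnegative residual constant. The choice
  -- c = (κ/2)^(s+1) turns the denominator of `maxStep` into κ.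
  set κ : ℝ := max 4 (64 * A)
  have hκ4 : 4 ≤ κ := le_max_left _ _
  have hκ0 : 0 < κ := by linarith
  have hκ : 2 * ((κ / 2) ^ ((s : ℝ) + 1)) ^ (1 / ((s : ℝ) + 1)) = κ := by
    rw [← Real.rpow_mul (by positivity), mul_one_div_cancel (by positivity), Real.rpow_one]
    ring
  refine ⟨(κ / 2) ^ ((s : ℝ) + 1), by positivity, 6 * κ, by positivity, ?_⟩
  intro d f μ L xs y₀ hμ hq hsm
  -- In dimension 0 the inequality μ ≤ L may fail, but 𝓔 vanishes identically.
  rcases Nat.eq_zero_or_pos d with rfl | hd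
  · have hE : ∀ y, lyapunov f μ L xs y = 0 := fun y => by
      rw [lyapunov, Subsingleton.elim y.2 xs, Subsingleton.elim y.1 0]
      simp
    refine ⟨fun h _ _ N => by simp [hE], fun ε hε h _ => ⟨0, by simp [algorithm_queries, hE], ?_⟩⟩
    intro n _
    refine le_trans (le_of_eq (sub_eq_zero.2 (congrArg f (Subsingleton.elim _ _)))) hε.le
  have : Nonempty (Fin d) := ⟨⟨0, hd⟩⟩
  have hf := hsm.differentiable
  have hgs := hsm.smoothBound_gradient
  obtain ⟨hL, hg⟩ := hq.le_and_norm_gradient_sq_le hμ hf (hgs.norm_sub_le hs0)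
  set E := lyapunov f μ L xs
  have hE : ∀ y, 0 ≤ E y := fun y => (lyapunov_bounds hμ hL hq.1 y).2.2.2
  set m := max (E y₀) (L / μ)
  have hm : 1 ≤ m := ((one_le_div hμ).2 hL).trans (le_max_right _ _)
  have hmain : ∀ h : ℝ, 0 < h → h ≤ m ^ (-gam s) / κ → ∀ N : ℕ,
      E (M.iter (field μ L (gradient f)) h y₀ N) ≤ (1 - h / 4) ^ N * E y₀ := by
    intro h hh hle
    obtain ⟨hh4, hhm, hsmall⟩ := step_size_bounds hs0 hm hκ4 hh hle
    refine ExplicitRK.lyapunov_iter_le (m := m) hE hh hh4 (fun y hy => ?_) (le_max_left _ _)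
    refine lyapunov_step_le (C := κ / 64) (fun F hF h0 => ?_) (by positivity) hμ hL hf hq hgs
      hg hy (le_max_right _ _) hh hh4 hhm ?_
    · obtain ⟨ρ, hρ⟩ := hA F hF h0
      refine ⟨ρ, fun t ht => ⟨(hρ t ht).1, (hρ t ht).2.trans ?_⟩⟩
      refine mul_le_mul_of_nonneg_right ?_ (pow_nonneg ht.1 s)
      have : 64 * A ≤ κ := le_max_right _ _
      linarith
    · have h1 : √(L / μ) * (√m * h) ^ s ≤ κ⁻¹ :=
        (mul_le_mul_of_nonneg_right (Real.sqrt_le_sqrt (le_max_right _ _))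
          (by positivity)).trans hsmall
      have h2 := mul_le_mul_of_nonneg_left h1 hκ0.le
      rw [mul_inv_cancel₀ hκ0.ne'] at h2
      linarith
  simp only [maxStep, hκ]
  refine ⟨hmain, fun ε hε h hh => ?_⟩
  have hh0 : 0 < h := by rw [hh]; positivity
  have hh4 := (step_size_bounds hs0 hm hκ4 hh0 hh.le).1
  obtain ⟨N, hN, hN'⟩ := exists_steps_le hh0 hh4 hε (mul_nonneg hμ.le (hE y₀))
  refine ⟨N, ?_, fun n hn => ?_⟩
  · have h1 : 6 / h = 6 * κ * m ^ gam s := by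
      rw [hh, Real.rpow_neg (by positivity)]
      field_simp
      rfl
    rw [algorithm_queries]
    push_cast
    rw [h1] at hN
    refine (mul_le_mul_of_nonneg_left hN (Nat.cast_nonneg _)).trans (le_of_eq ?_)
    ring
  · rw [algorithm_eval]
    have h1 := (lyapunov_bounds hμ hL hq.1 (M.iter (field μ L (gradient f)) h y₀ n)).1
    have h2 := hmain h hh0 hh.le n
    have h3 := hN' n hn
    rw [div_le_iff₀ hμ] at h1
    have h4 := mul_le_mul_of_nonneg_right h2 hμ.le
    linarith
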